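/- Let $c_1,c_2,h>0$ and $g,q\in\mathbb R$. Consider the closed loop of the string $$u_{tt}=c_1^2u_{xx}\ \ (0<x<1),\qquad u_x(0,t)=g\,u_t(0,t),\qquad u(1,t)=v(0,t),$$ and the dynamic controller $$v_{tt}=c_2^2v_{xx}\ \ (0<x<1),\qquad v_x(0,t)=u_x(1,t),\qquad v_x(1,t)=-h\,v_t(1,t)-q\,v(1,t).$$ Let $$\mathcal H=\{(u,u_t,v,v_t)\in H^1\times L^2\times H^1\times L^2:\ u(1)=v(0)\}$$ (Sobolev and Lebesgue spaces of real functions on $[0,1]$, $\mathcal H$ with the product topology), with the seminorm $$\|(u,u_t,v,v_t)\|_{\mathcal H}^2=c_1^2\|u_x\|_{L^2}^2+\|u_t\|_{L^2}^2+c_2^2\|v_x\|_{L^2}^2+\|v_t\|_{L^2}^2 .$$ Let $T(u,u_t,v,v_t)=(u_t,\,c_1^2u_{xx},\,v_t,\,c_2^2v_{xx})$ be the operator of the closed loop, whose domain $D(T)$ consists of the $(u,u_t,v,v_t)\in\mathcal H$ with $u,v\in H^2$, $u_t,v_t\in H^1$, $u_t(1)=v_t(0)$, $u_x(0)=g\,u_t(0)$,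 $v_x(0)=u_x(1)$ and $v_x(1)=-h\,v_t(1)-q\,v(1)$. The closed loop is called dissipative in $(\mathcal H,\|\cdot\|_{\mathcal H})$ if there is a seminorm $N$ on $\mathcal H$ which is equivalent to $\|\cdot\|_{\mathcal H}$ (that is, $m\|X\|_{\mathcal H}\le N(X)\le M\|X\|_{\mathcal H}$ for all $X\in\mathcal H$, with constants $m,M>0$) and whose time derivative along the closed loop is nowhere positive: $$\frac{d}{d\tau}\Big|_{\tau=0^+}N(X+\tau\,TX)\le 0\qquad\text{for all }X\in D(T).$$ Suppose that the closed loop is dissipative in $(\mathcal H,\|\cdot\|_{\mathcal H})$. Then for every initial condition $X_0=(u^0,u_t^0,v^0,v_t^0)\in\mathcal H$ the closed loop has a unique solution, that is, there is exactly one continuous $X:[0,\infty)\to\mathcal H$ such that $\int_0^tX(s)\,ds\in D(T)$ and $$X(t)=X_0+T\int_0^tX(s)\,ds\qquad\text{for all }t\ge0 .$$ -/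

import Mathlib

open MeasureTheory

noncomputable section

namespace StringLoop

/-- The space `L²([0,1]; ℝ)`. -/
abbrev L2 : Type := Lp ℝ 2 (volume.restrict (Set.Icc (0 : ℝ) 1))

theorem intervalIntegrable_L2 (w : L2) (x : unitInterval) :
    IntervalIntegrable (fun y => w y) volume 0 (x : ℝ) := by
  have h : Integrable (fun y => w y) (volume.restrict (Set.Icc (0 : ℝ) 1)) :=
    (Lp.memLp w).integrable (by norm_num)
  rw [intervalIntegrable_iff_integrableOn_Ioc_of_le x.2.1]
  exact IntegrableOn.mono_set h
    (show Set.Ioc 0 (x : ℝ) ⊆ Set.Icc (0 : ℝ) 1 from fun y hy => ⟨hy.1.le, hy.2.trans x.2.2⟩)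

theorem Ioc_subset (x : unitInterval) : Set.Ioc (0 : ℝ) x ⊆ Set.Icc (0 : ℝ) 1 :=
  fun _ hy => ⟨hy.1.le, hy.2.trans x.2.2⟩

theorem ae_restrict_Ioc (x : unitInterval) {p : ℝ → Prop}
    (h : ∀ᵐ y ∂(volume.restrict (Set.Icc (0 : ℝ) 1)), p y) :
    ∀ᵐ y ∂(volume.restrict (Set.Ioc (0 : ℝ) x)), p y :=
  ae_restrict_of_ae_restrict_of_subset (Ioc_subset x) h

/-- The primitive `x ↦ ∫₀ˣ w` of `w ∈ L²`, linear in `w`. -/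
def primitiveAt (x : unitInterval) : L2 →ₗ[ℝ] ℝ where
  toFun w := ∫ y in (0 : ℝ)..x, w y
  map_add' w w' := by
    rw [← intervalIntegral.integral_add (intervalIntegrable_L2 w x) (intervalIntegrable_L2 w' x)]
    rw [intervalIntegral.integral_of_le x.2.1, intervalIntegral.integral_of_le x.2.1]
    refine integral_congr_ae ?_
    filter_upwards [ae_restrict_Ioc x (Lp.coeFn_add w w')] with y hy
    simpa using hy
  map_smul' c w := by
    rw [RingHom.id_apply, smul_eq_mul, ← intervalIntegral.integral_const_mul]
    rw [intervalIntegral.integral_of_le x.2.1, intervalIntegral.integral_of_le x.2.1]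
    refine integral_congr_ae ?_
    filter_upwards [ae_restrict_Ioc x (Lp.coeFn_smul c w)] with y hy
    simpa using hy

theorem continuous_primitiveAt (x : unitInterval) : Continuous (primitiveAt x) := by
  refine (LinearMap.mkContinuous (primitiveAt x) 1 fun w => ?_).continuous
  have h1 : Integrable (fun y => w y) (volume.restrict (Set.Icc (0 : ℝ) 1)) :=
    (Lp.memLp w).integrable (by norm_num)
  have hle : ‖∫ y in (0 : ℝ)..x, w y‖ ≤ ∫ y in Set.Icc (0 : ℝ) 1, ‖w y‖ := by
    rw [intervalIntegral.integral_of_le x.2.1]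
    refine (norm_integral_le_integral_norm _).trans ?_
    refine setIntegral_mono_set h1.norm (Filter.Eventually.of_forall fun _ => norm_nonneg _) ?_
    exact Filter.Eventually.of_forall fun y hy => ⟨hy.1.le, hy.2.trans x.2.2⟩
  have h2 : ∫ y in Set.Icc (0 : ℝ) 1, ‖w y‖
      = (eLpNorm (fun y => w y) 1 (volume.restrict (Set.Icc (0 : ℝ) 1))).toReal := by
    rw [integral_norm_eq_lintegral_enorm h1.aestronglyMeasurable, eLpNorm_one_eq_lintegral_enorm]
  have h3 : eLpNorm (fun y => w y) 1 (volume.restrict (Set.Icc (0 : ℝ) 1))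
      ≤ eLpNorm (fun y => w y) 2 (volume.restrict (Set.Icc (0 : ℝ) 1)) := by
    have : IsProbabilityMeasure (volume.restrict (Set.Icc (0 : ℝ) 1)) := ⟨by simp⟩
    exact eLpNorm_le_eLpNorm_of_exponent_le (by norm_num) h1.aestronglyMeasurable
  rw [one_mul, Lp.norm_def]
  exact hle.trans (h2.le.trans (ENNReal.toReal_mono (Lp.eLpNorm_ne_top w) h3))

/-- The Sobolev space `H¹ = H¹((0,1); ℝ)`. An element is a pair `(z, z_x)` of the continuous
representative `z` on `[0,1]` and the derivative `z_x ∈ L²`, with `z(x) = z(0) + ∫₀ˣ z_x`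
for all `x ∈ [0,1]`. The topology, given by `‖z‖_∞` and `‖z_x‖_{L²}`, is the usual one of `H¹`. -/
def h1Submodule : Submodule ℝ (C(unitInterval, ℝ) × L2) where
  carrier := {p | ∀ x : unitInterval, p.1 x = p.1 0 + primitiveAt x p.2}
  add_mem' {p p'} hp hp' x := by
    have h := hp x
    have h' := hp' x
    simp only [Prod.fst_add, Prod.snd_add, ContinuousMap.add_apply, map_add]
    linarith
  zero_mem' x := by simp
  smul_mem' c p hp x := by
    have h := hp x
    simp only [Prod.smul_fst, Prod.smul_snd, ContinuousMap.smul_apply, map_smul, smul_eq_mul]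
    rw [h]; ring

/-- The type of elements of the Sobolev space `H¹`. -/
abbrev H1 : Type := h1Submodule

/-- The value `z(x)` at a point `x` of `[0,1]`. -/
def H1.at (z : H1) (x : unitInterval) : ℝ := z.1.1 x

/-- The derivative `z_x ∈ L²` of `z ∈ H¹`. -/
def H1.dx (z : H1) : L2 := z.1.2

/-- `w ∈ L²` equals (almost everywhere) the function `z ∈ H¹`. -/
def H1.Represents (z : H1) (w : L2) : Prop :=
  ∀ᵐ x ∂(volume.restrict (Set.Icc (0 : ℝ) 1)), w x = Set.IccExtend zero_le_one z.1.1 x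

theorem isClosed_H1 : IsClosed (h1Submodule : Set (C(unitInterval, ℝ) × L2)) := by
  have : (h1Submodule : Set (C(unitInterval, ℝ) × L2))
      = ⋂ x : unitInterval, {p | p.1 x = p.1 0 + primitiveAt x p.2} := by
    ext p; simp [h1Submodule]
  rw [this]
  refine isClosed_iInter fun x => isClosed_eq ?_ ?_
  · exact (continuous_eval_const x).comp continuous_fst
  · exact ((continuous_eval_const 0).comp continuous_fst).add
      ((continuous_primitiveAt x).comp continuous_snd)

instance : CompleteSpace H1 := isClosed_H1.completeSpace_coe

/-- The state space `𝓗 = {(u, u_t, v, v_t) ∈ H¹ × L² × H¹ × L² : u(1) = v(0)}`, where `u` and `v`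
are given with their derivatives, as pairs `(u, u_x)` and `(v, v_x)`. -/
def stateSubmodule :
    Submodule ℝ ((C(unitInterval, ℝ) × L2) × L2 × (C(unitInterval, ℝ) × L2) × L2) where
  carrier := {X | X.1 ∈ h1Submodule ∧ X.2.2.1 ∈ h1Submodule ∧ X.1.1 1 = X.2.2.1.1 0}
  add_mem' {X X'} h h' := by
    refine ⟨h1Submodule.add_mem h.1 h'.1, h1Submodule.add_mem h.2.1 h'.2.1, ?_⟩
    simp [h.2.2, h'.2.2]
  zero_mem' := ⟨h1Submodule.zero_mem, h1Submodule.zero_mem, by simp⟩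
  smul_mem' c X h := by
    refine ⟨h1Submodule.smul_mem c h.1, h1Submodule.smul_mem c h.2.1, ?_⟩
    simp [h.2.2]

/-- The type of elements of the state space `𝓗`. -/
abbrev State : Type := stateSubmodule

theorem isClosed_State :
    IsClosed (stateSubmodule :
      Set ((C(unitInterval, ℝ) × L2) × L2 × (C(unitInterval, ℝ) × L2) × L2)) := by
  have h1 : Continuous fun X : (C(unitInterval, ℝ) × L2) × L2 × (C(unitInterval, ℝ) × L2) × L2 =>
      X.1 := continuous_fst
  have h2 : Continuous fun X : (C(unitInterval, ℝ) × L2) × L2 × (C(unitInterval, ℝ) × L2) × L2 =>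
      X.2.2.1 := continuous_fst.comp (continuous_snd.comp continuous_snd)
  exact (isClosed_H1.preimage h1).inter ((isClosed_H1.preimage h2).inter
    (isClosed_eq ((continuous_eval_const 1).comp (continuous_fst.comp h1))
      ((continuous_eval_const 0).comp (continuous_fst.comp h2))))

instance : CompleteSpace State := isClosed_State.completeSpace_coe

namespace State

/-- The displacement of the string. -/
def u (X : State) : H1 := ⟨X.1.1, X.2.1⟩

/-- The velocity of the string. -/
def ut (X : State) : L2 := X.1.2.1

/-- The displacement of the controller. -/
def v (X : State) : H1 := ⟨X.1.2.2.1, X.2.2.1⟩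

/-- The velocity of the controller. -/
def vt (X : State) : L2 := X.1.2.2.2

end State

/-- The seminorm
`‖(u, u_t, v, v_t)‖_𝓗 = (c₁² ‖u_x‖² + ‖u_t‖² + c₂² ‖v_x‖² + ‖v_t‖²)^{1/2}`. -/
def energySeminorm (c₁ c₂ : ℝ) (X : State) : ℝ :=
  Real.sqrt (c₁ ^ 2 * ‖X.u.dx‖ ^ 2 + ‖X.ut‖ ^ 2 + c₂ ^ 2 * ‖X.v.dx‖ ^ 2 + ‖X.vt‖ ^ 2)

/-- The closed-loop operator `T`, as a relation: `X = (u, u_t, v, v_t)` lies in the domain of `T`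
and `Z = T X = (u_t, c₁² u_xx, v_t, c₂² v_xx)`.

The domain consists of the `X ∈ 𝓗` with `u, v ∈ H²`, `u_t, v_t ∈ H¹`, `u_t(1) = v_t(0)`
(this is contained in `Z ∈ 𝓗`) and
`u_x(0) = g u_t(0)`, `v_x(0) = u_x(1)`, `v_x(1) = - h v_t(1) - q v(1)`. -/
def IsOperatorValue (c₁ c₂ g h q : ℝ) (X Z : State) : Prop :=
  Z.u.Represents X.ut ∧ Z.v.Represents X.vt ∧
  ∃ ux vx : H1, ux.Represents X.u.dx ∧ vx.Represents X.v.dx ∧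
    Z.ut = c₁ ^ 2 • ux.dx ∧ Z.vt = c₂ ^ 2 • vx.dx ∧
    ux.at 0 = g * Z.u.at 0 ∧
    vx.at 0 = ux.at 1 ∧
    vx.at 1 = - h * Z.v.at 1 - q * X.v.at 1

/-- The closed loop is dissipative in `(𝓗, ‖·‖_𝓗)`: some seminorm `N` on `𝓗`, equivalent to
`‖·‖_𝓗`, does not increase along the flow, that is, `d/dt N ≤ 0` at every state `X` in the domain
of `T`, the (forward) time derivative being taken in the direction `dX/dt = T X`. -/
def IsDissipative (c₁ c₂ g h q : ℝ) : Prop :=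
  ∃ N : Seminorm ℝ State,
    (∃ m M : ℝ, 0 < m ∧ 0 < M ∧
      ∀ X, m * energySeminorm c₁ c₂ X ≤ N X ∧ N X ≤ M * energySeminorm c₁ c₂ X) ∧
    ∀ X Z : State, IsOperatorValue c₁ c₂ g h q X Z →
      ∃ d : ℝ, HasDerivWithinAt (fun τ : ℝ => N (X + τ • Z)) d (Set.Ici 0) 0 ∧ d ≤ 0

/-- `X : [0,∞) → 𝓗` is a (mild) solution of the closed loop with initial condition `X₀`:
it is continuous and `X(t) = X₀ + T ∫₀ᵗ X(s) ds` for all `t ≥ 0`, where the integral is in the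
domain of `T`. Values of `X` at negative times play no role. -/
def IsSolution (c₁ c₂ g h q : ℝ) (X₀ : State) (X : ℝ → State) : Prop :=
  ContinuousOn X (Set.Ici 0) ∧
  ∀ t : ℝ, 0 ≤ t → IsOperatorValue c₁ c₂ g h q (∫ s in (0 : ℝ)..t, X s) (X t - X₀)

end StringLoop

end

/-!
The closed loop is well posed because dissipativity forces everything else. Comparing the
derivative of `N` in the direction `TX` with that of an affine minorant gives the resolvent estimate
`r N(X) ≤ N(rX - TX)` for all `r > 0` (`IsLyapunov.mul_le`).

The seminorm `N` vanishes on the constant displacements `u = v = const`, so it is not a norm of the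
state space. But `N(X) + m |∫₀¹ u|` is an equivalent norm (`norm_le_meanU_add_energySeminorm`), and
since the mean of `TX` is `∫₀¹ u_t`, which the energy controls, the resolvent estimate survives with
growth rate `1` (`IsLyapunov.isGenerator`). No sign of `g` or `q` enters; in particular the
ill-posed value `g = -1/c₁` is excluded by the estimate itself.

For the range condition the resolvent equation is an ordinary differential equation on `[0,1]` with
`L²` right-hand side. It is solved by shooting from `x = 0`: all conditions but the last one hold
for every value of `u(0)`, and the defect in the last one is an affine function of `u(0)`, which is not
constant because the resolvent estimate rules out positive eigenvalues (`exists_shooting`,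
`IsLyapunov.exists_mem_graph`). The domain is dense because the functions of `H¹` that vanish at
both ends are dense in `L²`, and because one displacement with `v(1) = 1` in the domain accounts for the
boundary term `q v(1)` (`dense_domain`). The Hille–Yosida theorem, proved here with Yosida
approximations for the graph of an operator, then gives a mild solution
(`IsGenerator.exists_mild_solution`).

For uniqueness, the integral `V` of the difference of two solutions satisfies `V' = TV`, `V(0) = 0`.
Thus `N(V)` does not increase and is zero, so `V(t)` is a constant displacement with zero velocity.
Then `TV = V'` has vanishing displacements, and its remaining components vanish as derivatives of
vanishing components of `V` (`IsLyapunov.eq_zero_of_mild`).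
-/

noncomputable section

namespace StringLoop

open Filter Topology

/-! ### Normalised resolvents and Yosida approximations -/

section Generation

variable {E : Type*} [NormedAddCommGroup E] [NormedSpace ℝ E]

/-- Data of a (possibly unbounded) linear operator on `E`, given by its graph `G`, satisfying the
hypotheses of the Hille–Yosida theorem at the points `n + 1`. The resolvent equation is normalised:
`(x, (n + 1)(x - f)) ∈ G` says that `x = (n + 1)(n + 1 - T)⁻¹ f`. The seminorm `p` is an
equivalent norm of `E`, and the bound `(1 + 1 / (n + 1)) p f` allows for growth `eᵗ`. -/
structure IsGenerator (G : Submodule ℝ (E × E)) (p : Seminorm ℝ E) : Prop where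
  closed : IsClosed (G : Set (E × E))
  dense : Dense {x : E | ∃ z, (x, z) ∈ G}
  norm_le : ∃ a : ℝ, ∀ x, ‖x‖ ≤ a * p x
  le_norm : ∃ b : ℝ, ∀ x, p x ≤ b * ‖x‖
  range : ∀ (n : ℕ) (f : E), ∃ x, (x, ((n : ℝ) + 1) • (x - f)) ∈ G
  bound : ∀ (n : ℕ) (x f : E), (x, ((n : ℝ) + 1) • (x - f)) ∈ G →
    p x ≤ (1 + 1 / ((n : ℝ) + 1)) * p f

namespace IsGenerator

variable {G : Submodule ℝ (E × E)} {p : Seminorm ℝ E}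

/-- The solution of the resolvent equation is unique. -/
theorem eq_of_mem (hG : IsGenerator G p) {n : ℕ} {x y f : E}
    (hx : (x, ((n : ℝ) + 1) • (x - f)) ∈ G) (hy : (y, ((n : ℝ) + 1) • (y - f)) ∈ G) : x = y := by
  obtain ⟨a, ha⟩ := hG.norm_le
  have h : (x - y, ((n : ℝ) + 1) • ((x - y) - 0)) ∈ G := by
    convert! G.sub_mem hx hy using 1
    rw [Prod.mk_sub_mk, ← smul_sub]
    congr 2
    abel
  have h1 := hG.bound n _ _ h
  rw [map_zero, mul_zero] at h1
  have h2 := ha (x - y)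
  rw [le_antisymm h1 (apply_nonneg p _), mul_zero] at h2
  exact sub_eq_zero.1 (norm_le_zero_iff.1 h2)

/-- The normalised resolvent `(n + 1)(n + 1 - T)⁻¹`. -/
def res (hG : IsGenerator G p) (n : ℕ) : E →ₗ[ℝ] E where
  toFun f := (hG.range n f).choose
  map_add' f f' := by
    refine hG.eq_of_mem (hG.range n (f + f')).choose_spec ?_
    convert! G.add_mem (hG.range n f).choose_spec (hG.range n f').choose_spec using 1
    rw [Prod.mk_add_mk, ← smul_add]
    congr 2
    abel
  map_smul' c f := by
    refine hG.eq_of_mem (hG.range n (c • f)).choose_spec ?_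
    convert! G.smul_mem c (hG.range n f).choose_spec using 1
    rw [Prod.smul_mk, RingHom.id_apply, smul_comm c, smul_sub c]

theorem res_mem (hG : IsGenerator G p) (n : ℕ) (f : E) :
    (hG.res n f, ((n : ℝ) + 1) • (hG.res n f - f)) ∈ G :=
  (hG.range n f).choose_spec

theorem res_eq (hG : IsGenerator G p) {n : ℕ} {x f : E}
    (h : (x, ((n : ℝ) + 1) • (x - f)) ∈ G) : hG.res n f = x :=
  hG.eq_of_mem (hG.res_mem n f) h

theorem seminorm_res_pow_le (hG : IsGenerator G p) (n k : ℕ) (f : E) :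
    p ((hG.res n ^ k) f) ≤ (1 + 1 / ((n : ℝ) + 1)) ^ k * p f := by
  induction k with
  | zero => simp
  | succ k ih =>
    rw [pow_succ', Module.End.mul_apply]
    refine (hG.bound n _ _ (hG.res_mem n _)).trans ?_
    rw [pow_succ', mul_assoc]
    gcongr

/-- Powers are estimated in `p`, so that the constant of the norm equivalence enters only once. -/
theorem exists_norm_res_pow_le (hG : IsGenerator G p) :
    ∃ C : ℝ, 0 ≤ C ∧ ∀ (n k : ℕ) (f : E),
      ‖(hG.res n ^ k) f‖ ≤ C * (1 + 1 / ((n : ℝ) + 1)) ^ k * ‖f‖ := by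
  obtain ⟨a, ha⟩ := hG.norm_le
  obtain ⟨b, hb⟩ := hG.le_norm
  refine ⟨|a| * |b|, by positivity, fun n k f => ?_⟩
  have h1 : p f ≤ |b| * ‖f‖ :=
    (hb f).trans (mul_le_mul_of_nonneg_right (le_abs_self b) (norm_nonneg f))
  calc ‖(hG.res n ^ k) f‖ ≤ |a| * p ((hG.res n ^ k) f) :=
        (ha _).trans (mul_le_mul_of_nonneg_right (le_abs_self a) (apply_nonneg p _))
    _ ≤ |a| * ((1 + 1 / ((n : ℝ) + 1)) ^ k * (|b| * ‖f‖)) := by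
        gcongr
        exact (hG.seminorm_res_pow_le n k f).trans (by gcongr)
    _ = _ := by ring

/-- The normalised resolvent as a bounded operator. -/
def resL (hG : IsGenerator G p) (n : ℕ) : E →L[ℝ] E :=
  (hG.res n).mkContinuousOfExistsBound <| by
    obtain ⟨C, -, h⟩ := hG.exists_norm_res_pow_le
    exact ⟨_, fun f => by simpa using h n 1 f⟩

theorem resL_mem (hG : IsGenerator G p) (n : ℕ) (f : E) :
    (hG.resL n f, ((n : ℝ) + 1) • (hG.resL n f - f)) ∈ G :=
  hG.res_mem n f

theorem resL_eq (hG : IsGenerator G p) {n : ℕ} {x f : E}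
    (h : (x, ((n : ℝ) + 1) • (x - f)) ∈ G) : hG.resL n f = x :=
  hG.res_eq h

theorem exists_norm_resL_pow_le (hG : IsGenerator G p) :
    ∃ C : ℝ, 0 ≤ C ∧ ∀ (n k : ℕ), ‖hG.resL n ^ k‖ ≤ C * (1 + 1 / ((n : ℝ) + 1)) ^ k := by
  obtain ⟨C, hC, h⟩ := hG.exists_norm_res_pow_le
  refine ⟨C, hC, fun n k => ContinuousLinearMap.opNorm_le_bound _ (by positivity) fun f => ?_⟩
  have : (hG.resL n ^ k) f = (hG.res n ^ k) f := by
    induction k generalizing f with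
    | zero => rfl
    | succ k ih => rw [pow_succ, pow_succ]; exact ih _
  rw [this]
  exact h n k f

theorem exists_norm_resL_le (hG : IsGenerator G p) :
    ∃ C : ℝ, 0 ≤ C ∧ ∀ n : ℕ, ‖hG.resL n‖ ≤ C := by
  obtain ⟨C, hC, hb⟩ := hG.exists_norm_resL_pow_le
  refine ⟨2 * C, by positivity, fun n => ?_⟩
  have h1 := hb n 1
  rw [pow_one, pow_one] at h1
  have h2 : 1 / ((n : ℝ) + 1) ≤ 1 := by
    rw [div_le_one (by positivity)]
    linarith [Nat.cast_nonneg (α := ℝ) n]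
  nlinarith

theorem resL_commute (hG : IsGenerator G p) (n m : ℕ) : Commute (hG.resL n) (hG.resL m) := by
  rcases eq_or_ne n m with rfl | hnm
  · exact Commute.refl _
  -- the resolvent identity exhibits both products as `(μ J_n - λ J_m) / (μ - λ)`
  have key : ∀ (i j : ℕ), i ≠ j → ∀ f, hG.resL i (hG.resL j f) =
      ((j : ℝ) - i)⁻¹ • (((j : ℝ) + 1) • hG.resL i f - ((i : ℝ) + 1) • hG.resL j f) := by
    intro i j hij f
    have hne : (j : ℝ) - i ≠ 0 := sub_ne_zero.2 (by exact_mod_cast hij.symm)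
    refine hG.resL_eq ?_
    convert! G.smul_mem ((j : ℝ) - i)⁻¹ (G.sub_mem (G.smul_mem ((j : ℝ) + 1) (hG.resL_mem i f))
      (G.smul_mem ((i : ℝ) + 1) (hG.resL_mem j f))) using 1
    simp only [Prod.smul_mk, Prod.mk_sub_mk]
    congr 1
    match_scalars <;> field_simp <;> ring
  ext f
  change hG.resL n (hG.resL m f) = hG.resL m (hG.resL n f)
  rw [key n m hnm, key m n hnm.symm, ← neg_sub (n : ℝ) m, inv_neg]
  module

/-- The bounded Yosida approximation `T (n + 1)(n + 1 - T)⁻¹` of the operator `T`. -/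
def yosida (hG : IsGenerator G p) (n : ℕ) : E →L[ℝ] E := ((n : ℝ) + 1) • (hG.resL n - 1)

theorem yosida_apply (hG : IsGenerator G p) (n : ℕ) (f : E) :
    hG.yosida n f = ((n : ℝ) + 1) • (hG.resL n f - f) := rfl

theorem yosida_commute (hG : IsGenerator G p) (n m : ℕ) :
    Commute (hG.yosida n) (hG.yosida m) :=
  (((hG.resL_commute n m).sub_left (Commute.one_left _)).sub_right
    ((Commute.one_right _))).smul_left _ |>.smul_right _

/-- On the domain, the Yosida approximation is `(n + 1)(n + 1 - T)⁻¹ T`. -/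
theorem yosida_eq (hG : IsGenerator G p) (n : ℕ) {x z : E} (h : (x, z) ∈ G) :
    hG.yosida n x = hG.resL n z := by
  refine (hG.resL_eq ?_).symm
  convert! G.smul_mem ((n : ℝ) + 1) (G.sub_mem (hG.resL_mem n x) h) using 1

/-- The normalised resolvents converge strongly to the identity: on the domain since
`n(n - T)⁻¹ y - y = (n - T)⁻¹ T y`, in general by density. -/
theorem tendsto_resL (hG : IsGenerator G p) (x : E) :
    Tendsto (fun n => hG.resL n x) atTop (𝓝 x) := by
  obtain ⟨C, hC, hb⟩ := hG.exists_norm_resL_le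
  rw [Metric.tendsto_atTop]
  intro ε hε
  obtain ⟨y, hy, z, hz⟩ := Metric.dense_iff.1 hG.dense x (ε / (2 * (C + 1))) (by positivity)
  rw [Metric.mem_ball, dist_eq_norm] at hy
  have hlim : Tendsto (fun n : ℕ => (1 / ((n : ℝ) + 1)) * (C * ‖z‖)) atTop (𝓝 0) := by
    simpa using tendsto_one_div_add_atTop_nhds_zero_nat.mul_const (C * ‖z‖)
  obtain ⟨N, hN⟩ := (hlim.eventually (gt_mem_nhds (half_pos hε))).exists_forall_of_atTop
  refine ⟨N, fun n hn => ?_⟩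
  have e1 : hG.resL n y - y = (1 / ((n : ℝ) + 1)) • hG.resL n z := by
    rw [← hG.yosida_eq n hz, yosida_apply, smul_smul, one_div, inv_mul_cancel₀ (by positivity),
      one_smul]
  have e2 : ‖hG.resL n y - y‖ < ε / 2 := by
    rw [e1, norm_smul, Real.norm_of_nonneg (by positivity)]
    refine lt_of_le_of_lt ?_ (hN n hn)
    gcongr
    exact (hG.resL n).le_of_opNorm_le (hb n) z
  have e3 : hG.resL n x - x = (hG.resL n y - y) - (hG.resL n (y - x) - (y - x)) := by
    rw [map_sub]; abel
  have e4 : ‖hG.resL n (y - x) - (y - x)‖ < ε / 2 := by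
    calc _ ≤ C * ‖y - x‖ + ‖y - x‖ :=
          (norm_sub_le _ _).trans (by gcongr; exact (hG.resL n).le_of_opNorm_le (hb n) _)
      _ = (C + 1) * ‖y - x‖ := by ring
      _ < (C + 1) * (ε / (2 * (C + 1))) := by gcongr
      _ = ε / 2 := by field_simp
  rw [dist_eq_norm, e3]
  linarith [norm_sub_le (hG.resL n y - y) (hG.resL n (y - x) - (y - x))]

end IsGenerator

end Generation

/-! ### The Hille–Yosida theorem -/

section Generation

variable {E : Type*} [NormedAddCommGroup E] [NormedSpace ℝ E]

theorem norm_exp_smul_le {𝔸 : Type*} [NormedRing 𝔸] [NormedAlgebra ℝ 𝔸] [CompleteSpace 𝔸]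
    {B : 𝔸} {C r : ℝ} (h : ∀ k, ‖B ^ k‖ ≤ C * r ^ k) {s : ℝ} (hs : 0 ≤ s) :
    ‖NormedSpace.exp (s • B)‖ ≤ C * Real.exp (s * r) := by
  have hsum : HasSum (fun k : ℕ => C * (((k.factorial : ℝ))⁻¹ * (s * r) ^ k))
      (C * Real.exp (s * r)) := by
    rw [Real.exp_eq_exp_ℝ]
    exact (NormedSpace.exp_series_hasSum_exp' (𝕂 := ℝ) (s * r)).mul_left C
  refine (NormedSpace.exp_series_hasSum_exp' (𝕂 := ℝ) (s • B)).norm_le_of_bounded hsum fun k => ?_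
  rw [smul_pow, norm_smul, norm_smul, norm_inv, norm_pow, Real.norm_of_nonneg hs,
    Real.norm_natCast, mul_pow]
  calc _ ≤ ((k.factorial : ℝ))⁻¹ * (s ^ k * (C * r ^ k)) := by gcongr; exact h k
    _ = _ := by ring

/-- Obtained by integrating the derivative of `s ↦ exp((t - s)A) exp(sB) x`. -/
theorem norm_exp_smul_apply_sub_le [CompleteSpace E] {A B : E →L[ℝ] E} (hAB : Commute A B) {C : ℝ}
    (hA : ∀ t, 0 ≤ t → ‖NormedSpace.exp (t • A)‖ ≤ C * Real.exp t)
    (hB : ∀ t, 0 ≤ t → ‖NormedSpace.exp (t • B)‖ ≤ C * Real.exp t) (x : E) {t : ℝ} (ht : 0 ≤ t) :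
    ‖NormedSpace.exp (t • A) x - NormedSpace.exp (t • B) x‖
      ≤ C ^ 2 * Real.exp t * ‖A x - B x‖ * t := by
  have hd : ∀ s : ℝ, HasDerivAt
      (fun s => (NormedSpace.exp ((t - s) • A) * NormedSpace.exp (s • B)) x)
      ((NormedSpace.exp ((t - s) • A) * NormedSpace.exp (s • B)) (B x - A x)) s := by
    intro s
    have h1 : HasDerivAt (fun s : ℝ => NormedSpace.exp ((t - s) • A))
        (-(NormedSpace.exp ((t - s) • A) * A)) s := by
      convert! (hasDerivAt_exp_smul_const A (t - s)).scomp s ((hasDerivAt_id s).const_sub t) using 1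
      simp
    have h2 := (h1.mul (hasDerivAt_exp_smul_const B s)).clm_apply (hasDerivAt_const s x)
    have hc : NormedSpace.exp (s • B) * A = A * NormedSpace.exp (s • B) :=
      (((hAB.smul_right s).exp_right).eq).symm
    convert! h2 using 1
    simp only [map_sub, map_zero, add_zero, neg_mul]
    rw [mul_assoc, ← hc, ← mul_assoc, ← mul_assoc]
    simp only [add_apply, neg_apply, mul_apply_eq_comp]
    abel
  have hC : 0 ≤ C := by
    have := (norm_nonneg _).trans (hA 0 le_rfl)
    simpa using this
  have h3 := norm_image_sub_le_of_norm_deriv_le_segment' (C := C ^ 2 * Real.exp t * ‖A x - B x‖)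
    (fun s (_ : s ∈ Set.Icc 0 t) => (hd s).hasDerivWithinAt) (fun s hs => ?_) t ⟨ht, le_rfl⟩
  · rw [sub_zero] at h3
    simpa [norm_sub_rev] using h3
  · rw [norm_sub_rev (A x)]
    refine ContinuousLinearMap.le_of_opNorm_le _ ?_ _
    calc _ ≤ ‖NormedSpace.exp ((t - s) • A)‖ * ‖NormedSpace.exp (s • B)‖ := norm_mul_le _ _
      _ ≤ (C * Real.exp (t - s)) * (C * Real.exp s) := by
          gcongr
          · exact hA _ (by linarith [hs.2])
          · exact hB _ hs.1
      _ = C ^ 2 * (Real.exp (t - s) * Real.exp s) := by ring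
      _ = C ^ 2 * Real.exp t := by rw [← Real.exp_add, sub_add_cancel]

namespace IsGenerator

variable {G : Submodule ℝ (E × E)} {p : Seminorm ℝ E}

/-- The exponent `-(n + 1)t` from the identity cancels against the growth `(n + 1)t + t` of the
exponential of the resolvent. -/
theorem exists_norm_exp_yosida_le [CompleteSpace E] (hG : IsGenerator G p) :
    ∃ C : ℝ, 0 ≤ C ∧ ∀ (n : ℕ) (t : ℝ), 0 ≤ t →
      ‖NormedSpace.exp (t • hG.yosida n)‖ ≤ C * Real.exp t := by
  obtain ⟨C, hC, hb⟩ := hG.exists_norm_resL_pow_le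
  refine ⟨C, hC, fun n t ht => ?_⟩
  let _ : NormedAlgebra ℚ (E →L[ℝ] E) := NormedAlgebra.restrictScalars ℚ ℝ _
  have e : t • hG.yosida n = algebraMap ℝ (E →L[ℝ] E) (-(t * ((n : ℝ) + 1)))
      + (t * ((n : ℝ) + 1)) • hG.resL n := by
    rw [yosida, Algebra.algebraMap_eq_smul_one]
    module
  have h1 := norm_exp_smul_le (hb n) (s := t * ((n : ℝ) + 1)) (by positivity)
  rw [e, NormedSpace.exp_add_of_commute (Algebra.commutes _ _), ← NormedSpace.algebraMap_exp_comm,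
    ← Algebra.smul_def, norm_smul, ← Real.exp_eq_exp_ℝ, Real.norm_of_nonneg (Real.exp_nonneg _)]
  calc _ ≤ Real.exp (-(t * ((n : ℝ) + 1)))
          * (C * Real.exp (t * ((n : ℝ) + 1) * (1 + 1 / ((n : ℝ) + 1)))) := by gcongr
    _ = C * (Real.exp (-(t * ((n : ℝ) + 1)))
          * Real.exp (t * ((n : ℝ) + 1) * (1 + 1 / ((n : ℝ) + 1)))) := by ring
    _ = C * Real.exp t := by
        rw [← Real.exp_add]
        congr 2
        field_simp
        ring

/-- The exponentials of the Yosida approximations form a uniform Cauchy sequence on bounded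
intervals: on the domain by the bound for differences of exponentials, in general by density. -/
theorem uniformCauchySeqOn_exp_yosida [CompleteSpace E] (hG : IsGenerator G p) (x : E) (τ : ℝ) :
    UniformCauchySeqOn (fun n t => NormedSpace.exp (t • hG.yosida n) x) atTop (Set.Icc 0 τ) := by
  obtain ⟨C, hC, hb⟩ := hG.exists_norm_exp_yosida_le
  rw [Metric.uniformCauchySeqOn_iff]
  intro ε hε
  rcases lt_or_ge τ 0 with hτ | hτ
  · exact ⟨0, fun m _ n _ t ht => absurd (ht.1.trans ht.2) (not_le.2 hτ)⟩
  have hK : 0 < C * Real.exp τ + 1 := by positivity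
  obtain ⟨y, hy, z, hz⟩ := Metric.dense_iff.1 hG.dense x (ε / (4 * (C * Real.exp τ + 1)))
    (by positivity)
  rw [Metric.mem_ball, dist_eq_norm] at hy
  have hCs : CauchySeq fun n => hG.yosida n y := by
    simp_rw [hG.yosida_eq _ hz]
    exact (hG.tendsto_resL z).cauchySeq
  obtain ⟨N, hN⟩ := Metric.cauchySeq_iff.1 hCs (ε / (2 * (C ^ 2 * Real.exp τ * τ + 1)))
    (by positivity)
  refine ⟨N, fun m hm n hn t ht => ?_⟩
  have hbd : ∀ k, ‖NormedSpace.exp (t • hG.yosida k) (y - x)‖ < ε / 4 := fun k => by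
    calc _ ≤ C * Real.exp t * ‖y - x‖ := ContinuousLinearMap.le_of_opNorm_le _ (hb k t ht.1) _
      _ ≤ (C * Real.exp τ + 1) * ‖y - x‖ := by
          gcongr
          have : Real.exp t ≤ Real.exp τ := Real.exp_le_exp.2 ht.2
          nlinarith
      _ < (C * Real.exp τ + 1) * (ε / (4 * (C * Real.exp τ + 1))) := by gcongr
      _ = ε / 4 := by field_simp
  have hmid : ‖NormedSpace.exp (t • hG.yosida m) y - NormedSpace.exp (t • hG.yosida n) y‖
      < ε / 2 := by
    have h1 := hN m hm n hn
    rw [dist_eq_norm] at h1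
    calc _ ≤ C ^ 2 * Real.exp t * ‖hG.yosida m y - hG.yosida n y‖ * t :=
          norm_exp_smul_apply_sub_le (hG.yosida_commute m n) (hb m) (hb n) y ht.1
      _ ≤ C ^ 2 * Real.exp τ * ‖hG.yosida m y - hG.yosida n y‖ * τ := by
          gcongr
          · exact ht.1
          · exact ht.2
          · exact ht.2
      _ ≤ (C ^ 2 * Real.exp τ * τ + 1) * ‖hG.yosida m y - hG.yosida n y‖ := by
          nlinarith [norm_nonneg (hG.yosida m y - hG.yosida n y)]
      _ < (C ^ 2 * Real.exp τ * τ + 1) * (ε / (2 * (C ^ 2 * Real.exp τ * τ + 1))) := by gcongr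
      _ = ε / 2 := by field_simp
  have e : NormedSpace.exp (t • hG.yosida m) x - NormedSpace.exp (t • hG.yosida n) x =
      (NormedSpace.exp (t • hG.yosida m) y - NormedSpace.exp (t • hG.yosida n) y)
      - NormedSpace.exp (t • hG.yosida m) (y - x)
      + NormedSpace.exp (t • hG.yosida n) (y - x) := by
    simp only [map_sub]; abel
  rw [dist_eq_norm, e]
  refine (norm_add_le _ _).trans_lt ((add_le_add_left (norm_sub_le _ _) _).trans_lt ?_)
  linarith [hbd m, hbd n]

/-- Hille–Yosida: the abstract Cauchy problem has a mild solution for every initial value. -/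
theorem exists_mild_solution [CompleteSpace E] (hG : IsGenerator G p) (x : E) :
    ∃ X : ℝ → E, ContinuousOn X (Set.Ici 0) ∧
      ∀ t : ℝ, 0 ≤ t → (∫ s in (0 : ℝ)..t, X s, X t - x) ∈ G := by
  set S : ℕ → ℝ → E := fun n t => NormedSpace.exp (t • hG.yosida n) x with hS
  have hder : ∀ n t, HasDerivAt (S n) (hG.yosida n (S n t)) t := fun n t => by
    have h := (hasDerivAt_exp_smul_const (hG.yosida n) t).clm_apply (hasDerivAt_const t x)
    have hc : NormedSpace.exp (t • hG.yosida n) * hG.yosida n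
        = hG.yosida n * NormedSpace.exp (t • hG.yosida n) :=
      (((Commute.refl (hG.yosida n)).smul_right t).exp_right).eq.symm
    rw [hc, map_zero, add_zero] at h
    exact h
  have hScont : ∀ n, Continuous (S n) := fun n =>
    continuous_iff_continuousAt.2 fun t => (hder n t).continuousAt
  have hlim : ∀ t, ∃ y, 0 ≤ t → Tendsto (fun n => S n t) atTop (𝓝 y) := fun t => by
    by_cases ht : 0 ≤ t
    · obtain ⟨y, hy⟩ := cauchySeq_tendsto_of_complete
        ((hG.uniformCauchySeqOn_exp_yosida x t).cauchySeq (x := t) ⟨ht, le_rfl⟩)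
      exact ⟨y, fun _ => hy⟩
    · exact ⟨0, fun h => absurd h ht⟩
  choose X hX using hlim
  have hunif : ∀ τ, TendstoUniformlyOn S X atTop (Set.Icc 0 τ) := fun τ =>
    (hG.uniformCauchySeqOn_exp_yosida x τ).tendstoUniformlyOn_of_tendsto fun t ht => hX t ht.1
  have hXcont : ∀ τ, ContinuousOn X (Set.Icc 0 τ) := fun τ =>
    (hunif τ).continuousOn (Frequently.of_forall fun n => (hScont n).continuousOn)
  refine ⟨X, fun t ht => ?_, fun t ht => ?_⟩
  · refine ((hXcont (t + 1)) t ⟨ht, by linarith⟩).mono_of_mem_nhdsWithin ?_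
    rw [← Set.Ici_inter_Iic]
    exact inter_mem self_mem_nhdsWithin (mem_nhdsWithin_of_mem_nhds (Iic_mem_nhds (by linarith)))
  -- the integrals of the approximations converge, and the graph is closed
  have hXint : IntervalIntegrable X volume 0 t :=
    ContinuousOn.intervalIntegrable (by rw [Set.uIcc_of_le ht]; exact hXcont t)
  have hint : Tendsto (fun n => ∫ s in (0 : ℝ)..t, S n s) atTop (𝓝 (∫ s in (0 : ℝ)..t, X s)) := by
    rw [Metric.tendsto_atTop]
    intro ε hε
    obtain ⟨N, hN⟩ := (Metric.tendstoUniformlyOn_iff.1 (hunif t) (ε / (t + 1))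
      (by positivity)).exists_forall_of_atTop
    refine ⟨N, fun n hn => ?_⟩
    rw [dist_eq_norm, ← intervalIntegral.integral_sub ((hScont n).intervalIntegrable 0 t) hXint]
    have h1 : ‖∫ s in (0 : ℝ)..t, (S n s - X s)‖ ≤ ε / (t + 1) * |t - 0| := by
      refine intervalIntegral.norm_integral_le_of_norm_le_const fun s hs => ?_
      rw [Set.uIoc_of_le ht] at hs
      have := hN n hn s ⟨hs.1.le, hs.2⟩
      rw [dist_comm, dist_eq_norm] at this
      exact this.le
    refine h1.trans_lt ?_
    rw [sub_zero, abs_of_nonneg ht, div_mul_eq_mul_div, div_lt_iff₀ (by positivity)]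
    nlinarith
  have hres : Tendsto (fun n => hG.resL n (∫ s in (0 : ℝ)..t, S n s)) atTop
      (𝓝 (∫ s in (0 : ℝ)..t, X s)) := by
    obtain ⟨C, -, hb⟩ := hG.exists_norm_resL_le
    have h0 : Tendsto (fun n => hG.resL n ((∫ s in (0 : ℝ)..t, S n s) - ∫ s in (0 : ℝ)..t, X s))
        atTop (𝓝 0) := by
      refine squeeze_zero_norm (fun n => (hG.resL n).le_of_opNorm_le (hb n) _) ?_
      simpa using ((hint.sub_const (∫ s in (0 : ℝ)..t, X s)).norm).const_mul C
    simpa using h0.add (hG.tendsto_resL (∫ s in (0 : ℝ)..t, X s))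
  have hmem : ∀ n, (hG.resL n (∫ s in (0 : ℝ)..t, S n s), S n t - x) ∈ G := fun n => by
    have h1 : ∫ s in (0 : ℝ)..t, hG.yosida n (S n s) = S n t - S n 0 :=
      intervalIntegral.integral_eq_sub_of_hasDerivAt (fun s _ => hder n s)
        (((hG.yosida n).continuous.comp (hScont n)).intervalIntegrable 0 t)
    have h2 : S n 0 = x := by simp [hS]
    rw [ContinuousLinearMap.intervalIntegral_comp_comm _ ((hScont n).intervalIntegrable 0 t),
      h2] at h1
    rw [← h1]
    exact hG.resL_mem n _
  exact hG.closed.mem_of_tendsto (hres.prodMk_nhds ((hX t ht).sub_const x))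
    (Eventually.of_forall hmem)

end IsGenerator

end Generation

/-! ### Continuous functions and `L²` -/

section FunctionSpaces

instance : IsProbabilityMeasure (volume.restrict (Set.Icc (0 : ℝ) 1)) := ⟨by simp⟩

theorem continuous_iccExtend (f : C(unitInterval, ℝ)) :
    Continuous (Set.IccExtend zero_le_one f : ℝ → ℝ) :=
  f.continuous.Icc_extend'

theorem memLp_iccExtend (f : C(unitInterval, ℝ)) :
    MemLp (Set.IccExtend zero_le_one f : ℝ → ℝ) 2 (volume.restrict (Set.Icc (0 : ℝ) 1)) :=
  MemLp.of_bound (continuous_iccExtend f).aestronglyMeasurable ‖f‖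
    (Eventually.of_forall fun _ => f.norm_coe_le_norm _)

/-- The embedding of `C([0,1])` into `L²`. -/
def emb : C(unitInterval, ℝ) →L[ℝ] L2 :=
  LinearMap.mkContinuous
    { toFun f := (memLp_iccExtend f).toLp _
      map_add' _ _ := rfl
      map_smul' _ _ := rfl } 1 fun f => by
    have h := Lp.norm_le_of_ae_bound (f := (memLp_iccExtend f).toLp _) (norm_nonneg f) <| by
      filter_upwards [(memLp_iccExtend f).coeFn_toLp] with x hx
      rw [hx]
      exact f.norm_coe_le_norm _
    have h1 : measureUnivNNReal (volume.restrict (Set.Icc (0 : ℝ) 1)) = 1 := by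
      simp [measureUnivNNReal]
    rw [h1, NNReal.coe_one, Real.one_rpow] at h
    exact h

theorem coeFn_emb (f : C(unitInterval, ℝ)) :
    ∀ᵐ x ∂(volume.restrict (Set.Icc (0 : ℝ) 1)), emb f x = Set.IccExtend zero_le_one f x :=
  (memLp_iccExtend f).coeFn_toLp

theorem emb_eq_iff (f : C(unitInterval, ℝ)) (w : L2) :
    emb f = w ↔
      ∀ᵐ x ∂(volume.restrict (Set.Icc (0 : ℝ) 1)), w x = Set.IccExtend zero_le_one f x := by
  rw [Lp.ext_iff]
  constructor
  · intro h
    filter_upwards [h, coeFn_emb f] with x h1 h2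
    rw [← h1, h2]
  · intro h
    filter_upwards [h, coeFn_emb f] with x h1 h2
    rw [h1, h2]

theorem emb_injective : Function.Injective emb := by
  rw [injective_iff_map_eq_zero]
  intro f hf
  have h1 : ∀ᵐ x ∂(volume.restrict (Set.Icc (0 : ℝ) 1)),
      Set.IccExtend zero_le_one f x = (0 : ℝ) := by
    filter_upwards [(emb_eq_iff f 0).1 hf, Lp.coeFn_zero ℝ 2 _] with x h1 h2
    rw [← h1, h2, Pi.zero_apply]
  have h2 := Measure.eqOn_Icc_of_ae_eq volume zero_ne_one h1
    (continuous_iccExtend f).continuousOn continuousOn_const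
  ext x
  have := h2 x.2
  rwa [Set.IccExtend_val] at this

theorem abs_primitiveAt_le (x : unitInterval) (w : L2) : |primitiveAt x w| ≤ ‖w‖ := by
  have h1 : Integrable (fun y => w y) (volume.restrict (Set.Icc (0 : ℝ) 1)) :=
    (Lp.memLp w).integrable (by norm_num)
  have hle : ‖∫ y in (0 : ℝ)..x, w y‖ ≤ ∫ y in Set.Icc (0 : ℝ) 1, ‖w y‖ := by
    rw [intervalIntegral.integral_of_le x.2.1]
    exact (norm_integral_le_integral_norm _).trans
      (setIntegral_mono_set h1.norm (Eventually.of_forall fun _ => norm_nonneg _)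
        (Eventually.of_forall (Ioc_subset x)))
  have h3 : eLpNorm (fun y => w y) 1 (volume.restrict (Set.Icc (0 : ℝ) 1))
      ≤ eLpNorm (fun y => w y) 2 (volume.restrict (Set.Icc (0 : ℝ) 1)) :=
    eLpNorm_le_eLpNorm_of_exponent_le (by norm_num) h1.aestronglyMeasurable
  rw [integral_norm_eq_lintegral_enorm h1.aestronglyMeasurable,
    ← eLpNorm_one_eq_lintegral_enorm] at hle
  rw [Lp.norm_def]
  exact hle.trans (ENNReal.toReal_mono (Lp.eLpNorm_ne_top w) h3)

/-- The primitive `x ↦ ∫₀ˣ w` of `w ∈ L²` as a continuous function. -/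
def prim : L2 →L[ℝ] C(unitInterval, ℝ) :=
  LinearMap.mkContinuous
    { toFun w := ⟨fun x => primitiveAt x w, by
        have h : Integrable (fun y => w y) (volume.restrict (Set.Icc (0 : ℝ) 1)) :=
          (Lp.memLp w).integrable (by norm_num)
        have h2 := intervalIntegral.continuousOn_primitive_interval (a := 0) (b := 1)
          (f := fun y => w y) (μ := volume) (by rwa [Set.uIcc_of_le zero_le_one])
        rw [Set.uIcc_of_le zero_le_one] at h2
        exact continuousOn_iff_continuous_domRestrict.1 h2⟩
      map_add' w w' := by ext x; exact map_add (primitiveAt x) w w'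
      map_smul' c w := by ext x; exact map_smul (primitiveAt x) c w } 1 fun w => by
    rw [one_mul]
    exact (ContinuousMap.norm_le _ (norm_nonneg w)).2 fun x => abs_primitiveAt_le x w

theorem prim_apply (w : L2) (x : unitInterval) : prim w x = primitiveAt x w := rfl

theorem norm_prim_le (w : L2) : ‖prim w‖ ≤ ‖w‖ :=
  (ContinuousMap.norm_le _ (norm_nonneg w)).2 fun x => abs_primitiveAt_le x w

theorem norm_emb_le (f : C(unitInterval, ℝ)) : ‖emb f‖ ≤ ‖f‖ := by
  simpa using emb.le_of_opNorm_le (LinearMap.mkContinuous_norm_le _ zero_le_one _) f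

@[simp] theorem prim_zero_right (w : L2) : prim w 0 = 0 := by
  rw [prim_apply]
  exact intervalIntegral.integral_same

theorem prim_emb (f : C(unitInterval, ℝ)) (x : unitInterval) :
    prim (emb f) x = ∫ y in (0 : ℝ)..x, Set.IccExtend zero_le_one f y := by
  change ∫ y in (0 : ℝ)..x, emb f y = _
  rw [intervalIntegral.integral_of_le x.2.1, intervalIntegral.integral_of_le x.2.1]
  exact integral_congr_ae (ae_restrict_Ioc x (coeFn_emb f))

theorem mem_h1Submodule_iff (z : C(unitInterval, ℝ)) (w : L2) :
    (z, w) ∈ h1Submodule ↔ z = z 0 • 1 + prim w := by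
  constructor
  · intro h
    ext x
    simpa using! h x
  · intro h x
    have := congrArg (fun f : C(unitInterval, ℝ) => f x) h
    simpa using! this

/-- The element of `H¹` with a given value at `0` and a given derivative. -/
def H1.mk (c : ℝ) (w : L2) : H1 :=
  ⟨(c • 1 + prim w, w), (mem_h1Submodule_iff _ _).2 (by simp)⟩

theorem H1.represents_iff (z : H1) (w : L2) : z.Represents w ↔ emb z.1.1 = w :=
  (emb_eq_iff _ _).symm

end FunctionSpaces

/-! ### The graph of the closed-loop operator -/

section Graph

namespace State

/-- `u` as a continuous function. -/
def uC : State →L[ℝ] C(unitInterval, ℝ) :=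
  ((ContinuousLinearMap.fst ℝ _ _).comp (ContinuousLinearMap.fst ℝ _ _)).comp
    stateSubmodule.subtypeL

/-- The derivative `u_x`. -/
def uD : State →L[ℝ] L2 :=
  ((ContinuousLinearMap.snd ℝ _ _).comp (ContinuousLinearMap.fst ℝ _ _)).comp
    stateSubmodule.subtypeL

/-- The velocity `u_t` as a continuous linear map. -/
def utL : State →L[ℝ] L2 :=
  ((ContinuousLinearMap.fst ℝ _ _).comp (ContinuousLinearMap.snd ℝ _ _)).comp
    stateSubmodule.subtypeL

/-- `v` as a continuous function. -/
def vC : State →L[ℝ] C(unitInterval, ℝ) :=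
  ((ContinuousLinearMap.fst ℝ _ _).comp ((ContinuousLinearMap.fst ℝ _ _).comp
    ((ContinuousLinearMap.snd ℝ _ _).comp (ContinuousLinearMap.snd ℝ _ _)))).comp
    stateSubmodule.subtypeL

/-- The derivative `v_x`. -/
def vD : State →L[ℝ] L2 :=
  ((ContinuousLinearMap.snd ℝ _ _).comp ((ContinuousLinearMap.fst ℝ _ _).comp
    ((ContinuousLinearMap.snd ℝ _ _).comp (ContinuousLinearMap.snd ℝ _ _)))).comp
    stateSubmodule.subtypeL

/-- The velocity `v_t` as a continuous linear map. -/
def vtL : State →L[ℝ] L2 :=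
  ((ContinuousLinearMap.snd ℝ _ _).comp
    ((ContinuousLinearMap.snd ℝ _ _).comp (ContinuousLinearMap.snd ℝ _ _))).comp
    stateSubmodule.subtypeL

theorem ext_components {X Y : State} (h1 : uC X = uC Y) (h2 : uD X = uD Y) (h3 : utL X = utL Y)
    (h4 : vC X = vC Y) (h5 : vD X = vD Y) (h6 : vtL X = vtL Y) : X = Y :=
  Subtype.ext (Prod.ext (Prod.ext h1 h2) (Prod.ext h3 (Prod.ext (Prod.ext h4 h5) h6)))

theorem uC_eq (X : State) : uC X = uC X 0 • 1 + prim (uD X) :=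
  (mem_h1Submodule_iff _ _).1 X.2.1

theorem vC_eq (X : State) : vC X = vC X 0 • 1 + prim (vD X) :=
  (mem_h1Submodule_iff _ _).1 X.2.2.1

theorem uC_one (X : State) : uC X 1 = vC X 0 := X.2.2.2

/-- The state with given components. -/
def ofComponents (a : C(unitInterval, ℝ)) (a' w : L2) (b : C(unitInterval, ℝ)) (b' w' : L2)
    (ha : a = a 0 • 1 + prim a') (hb : b = b 0 • 1 + prim b') (hab : a 1 = b 0) : State :=
  ⟨((a, a'), w, (b, b'), w'), (mem_h1Submodule_iff _ _).2 ha, (mem_h1Submodule_iff _ _).2 hb, hab⟩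

end State

open State

theorem energySeminorm_eq (c₁ c₂ : ℝ) (X : State) :
    energySeminorm c₁ c₂ X =
      Real.sqrt (c₁ ^ 2 * ‖uD X‖ ^ 2 + ‖utL X‖ ^ 2 + c₂ ^ 2 * ‖vD X‖ ^ 2 + ‖vtL X‖ ^ 2) := rfl

variable (c₁ c₂ g h q : ℝ)

/-- For `Z = T X`, the continuous function `u_x` of `X`: its value at `0` is given by the boundary
condition at the end of the string and its derivative by the wave equation. -/
def uxL : State →L[ℝ] C(unitInterval, ℝ) :=
  g • ((ContinuousLinearMap.toSpanSingleton ℝ (1 : C(unitInterval, ℝ))).comp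
      ((ContinuousMap.evalCLM ℝ (0 : unitInterval)).comp uC))
    + ((c₁ ^ 2)⁻¹) • prim.comp utL

/-- For `Z = T X`, the continuous function `v_x` of `X`: its value at `0` is `u_x(1)`. -/
def vxL : State →L[ℝ] C(unitInterval, ℝ) :=
  (ContinuousLinearMap.toSpanSingleton ℝ (1 : C(unitInterval, ℝ))).comp
      ((ContinuousMap.evalCLM ℝ (1 : unitInterval)).comp (uxL c₁ g))
    + ((c₂ ^ 2)⁻¹) • prim.comp vtL

theorem uxL_apply (Z : State) :
    uxL c₁ g Z = (g * uC Z 0) • 1 + ((c₁ ^ 2)⁻¹) • prim (utL Z) := by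
  simp [uxL, smul_smul]

theorem vxL_apply (Z : State) :
    vxL c₁ c₂ g Z = (uxL c₁ g Z 1) • 1 + ((c₂ ^ 2)⁻¹) • prim (vtL Z) := by
  simp [vxL]

/-- The continuous linear map on pairs `(X, Z)` whose kernel is the graph of the closed-loop
operator. -/
def graphMap : (State × State) →L[ℝ] L2 × L2 × L2 × L2 × ℝ :=
  (utL.comp (.fst ℝ _ _) - emb.comp (uC.comp (.snd ℝ _ _))).prod <|
  (vtL.comp (.fst ℝ _ _) - emb.comp (vC.comp (.snd ℝ _ _))).prod <|
  (uD.comp (.fst ℝ _ _) - emb.comp ((uxL c₁ g).comp (.snd ℝ _ _))).prod <|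
  (vD.comp (.fst ℝ _ _) - emb.comp ((vxL c₁ c₂ g).comp (.snd ℝ _ _))).prod <|
  (ContinuousMap.evalCLM ℝ (1 : unitInterval)).comp ((vxL c₁ c₂ g).comp (.snd ℝ _ _))
    + h • (ContinuousMap.evalCLM ℝ (1 : unitInterval)).comp (vC.comp (.snd ℝ _ _))
    + q • (ContinuousMap.evalCLM ℝ (1 : unitInterval)).comp (vC.comp (.fst ℝ _ _))

/-- The graph of the closed-loop operator. -/
def graph : Submodule ℝ (State × State) := (graphMap c₁ c₂ g h q).ker

theorem isClosed_graph : IsClosed (graph c₁ c₂ g h q : Set (State × State)) :=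
  (graphMap c₁ c₂ g h q).isClosed_ker

variable {c₁ c₂ g h q}

theorem mem_graph_iff {X Z : State} : (X, Z) ∈ graph c₁ c₂ g h q ↔
    utL X = emb (uC Z) ∧ vtL X = emb (vC Z) ∧ uD X = emb (uxL c₁ g Z) ∧
      vD X = emb (vxL c₁ c₂ g Z) ∧ vxL c₁ c₂ g Z 1 + h * vC Z 1 + q * vC X 1 = 0 := by
  simp [graph, graphMap, sub_eq_zero]

theorem isOperatorValue_iff (hc₁ : 0 < c₁) (hc₂ : 0 < c₂) {X Z : State} :
    IsOperatorValue c₁ c₂ g h q X Z ↔ (X, Z) ∈ graph c₁ c₂ g h q := by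
  have e1 : ∀ w : L2, (c₁ ^ 2) • (c₁ ^ 2)⁻¹ • w = w := fun w => by
    rw [smul_smul, mul_inv_cancel₀ (by positivity), one_smul]
  have e2 : ∀ w : L2, (c₂ ^ 2) • (c₂ ^ 2)⁻¹ • w = w := fun w => by
    rw [smul_smul, mul_inv_cancel₀ (by positivity), one_smul]
  rw [mem_graph_iff]
  constructor
  · rintro ⟨h1, h2, ux, vx, h3, h4, h5, h6, h7, h8, h9⟩
    rw [H1.represents_iff] at h1 h2 h3 h4
    have h5' : utL Z = c₁ ^ 2 • ux.dx := h5
    have h6' : vtL Z = c₂ ^ 2 • vx.dx := h6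
    have eu : uxL c₁ g Z = ux.1.1 := by
      rw [(mem_h1Submodule_iff _ _).1 ux.2, uxL_apply, h5', map_smul, smul_smul,
        inv_mul_cancel₀ (by positivity), one_smul]
      exact congrArg₂ _ (congrArg (· • _) h7.symm) rfl
    have ev : vxL c₁ c₂ g Z = vx.1.1 := by
      rw [(mem_h1Submodule_iff _ _).1 vx.2, vxL_apply, h6', map_smul, smul_smul,
        inv_mul_cancel₀ (by positivity), one_smul, eu]
      exact congrArg₂ _ (congrArg (· • _) h8.symm) rfl
    refine ⟨h1.symm, h2.symm, ?_, ?_, ?_⟩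
    · rw [eu]; exact h3.symm
    · rw [ev]; exact h4.symm
    · rw [ev]
      have h9' : vx.1.1 1 = -h * vC Z 1 - q * vC X 1 := h9
      rw [h9']; ring
  · rintro ⟨h1, h2, h3, h4, h5⟩
    have eu : (H1.mk (g * uC Z 0) ((c₁ ^ 2)⁻¹ • utL Z)).1.1 = uxL c₁ g Z := by
      rw [uxL_apply, ← map_smul prim]; rfl
    have ev : (H1.mk (uxL c₁ g Z 1) ((c₂ ^ 2)⁻¹ • vtL Z)).1.1 = vxL c₁ c₂ g Z := by
      rw [vxL_apply, ← map_smul prim]; rfl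
    refine ⟨(H1.represents_iff _ _).2 h1.symm, (H1.represents_iff _ _).2 h2.symm,
      H1.mk (g * uC Z 0) ((c₁ ^ 2)⁻¹ • utL Z), H1.mk (uxL c₁ g Z 1) ((c₂ ^ 2)⁻¹ • vtL Z),
      ?_, ?_, (e1 _).symm, (e2 _).symm, ?_, ?_, ?_⟩
    · rw [H1.represents_iff, eu]; exact h3.symm
    · rw [H1.represents_iff, ev]; exact h4.symm
    · rw [H1.at, eu, uxL_apply]
      simp [H1.at, State.u, uC]
    · rw [H1.at, H1.at, eu, ev, vxL_apply]
      simp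
    · rw [H1.at, ev]
      change _ = -h * vC Z 1 - q * vC X 1
      linarith

end Graph

open State

/-! ### The energy and the resolvent estimate -/

section Energy

variable {c₁ c₂ : ℝ}

theorem energySeminorm_nonneg (X : State) : 0 ≤ energySeminorm c₁ c₂ X := Real.sqrt_nonneg _

theorem norm_utL_le_energySeminorm (X : State) : ‖utL X‖ ≤ energySeminorm c₁ c₂ X := by
  rw [energySeminorm_eq]
  refine Real.le_sqrt_of_sq_le ?_
  nlinarith [sq_nonneg (c₁ * ‖uD X‖), sq_nonneg (c₂ * ‖vD X‖), sq_nonneg (‖vtL X‖)]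

theorem norm_vtL_le_energySeminorm (X : State) : ‖vtL X‖ ≤ energySeminorm c₁ c₂ X := by
  rw [energySeminorm_eq]
  refine Real.le_sqrt_of_sq_le ?_
  nlinarith [sq_nonneg (c₁ * ‖uD X‖), sq_nonneg (c₂ * ‖vD X‖), sq_nonneg (‖utL X‖)]

theorem norm_uD_le_energySeminorm (hc₁ : 0 < c₁) (X : State) :
    ‖uD X‖ ≤ 1 / c₁ * energySeminorm c₁ c₂ X := by
  rw [one_div_mul_eq_div, le_div_iff₀ hc₁, energySeminorm_eq]
  refine Real.le_sqrt_of_sq_le ?_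
  nlinarith [sq_nonneg (‖utL X‖), sq_nonneg (c₂ * ‖vD X‖), sq_nonneg (‖vtL X‖)]

theorem norm_vD_le_energySeminorm (hc₂ : 0 < c₂) (X : State) :
    ‖vD X‖ ≤ 1 / c₂ * energySeminorm c₁ c₂ X := by
  rw [one_div_mul_eq_div, le_div_iff₀ hc₂, energySeminorm_eq]
  refine Real.le_sqrt_of_sq_le ?_
  nlinarith [sq_nonneg (‖utL X‖), sq_nonneg (c₁ * ‖uD X‖), sq_nonneg (‖vtL X‖)]

theorem norm_state_le_iff {X : State} {r : ℝ} : ‖X‖ ≤ r ↔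
    ‖uC X‖ ≤ r ∧ ‖uD X‖ ≤ r ∧ ‖utL X‖ ≤ r ∧ ‖vC X‖ ≤ r ∧ ‖vD X‖ ≤ r ∧ ‖vtL X‖ ≤ r := by
  have : ‖X‖ = max (max ‖uC X‖ ‖uD X‖) (max ‖utL X‖ (max (max ‖vC X‖ ‖vD X‖) ‖vtL X‖)) := rfl
  rw [this]
  simp only [max_le_iff, and_assoc]

theorem energySeminorm_le_norm (X : State) :
    energySeminorm c₁ c₂ X ≤ Real.sqrt (c₁ ^ 2 + 1 + c₂ ^ 2 + 1) * ‖X‖ := by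
  obtain ⟨-, h1, h2, -, h3, h4⟩ := norm_state_le_iff.1 (le_refl ‖X‖)
  rw [energySeminorm_eq]
  refine Real.sqrt_le_iff.2 ⟨by positivity, ?_⟩
  rw [mul_pow, Real.sq_sqrt (by positivity)]
  calc _ ≤ c₁ ^ 2 * ‖X‖ ^ 2 + ‖X‖ ^ 2 + c₂ ^ 2 * ‖X‖ ^ 2 + ‖X‖ ^ 2 := by gcongr
    _ = _ := by ring

/-- The mean `∫₀¹ u` of the displacement of the string. -/
def meanU : State →L[ℝ] ℝ :=
  (ContinuousMap.evalCLM ℝ (1 : unitInterval)).comp (prim.comp (emb.comp uC))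

theorem meanU_apply (X : State) : meanU X = prim (emb (uC X)) 1 := rfl

theorem prim_emb_one : prim (emb 1) 1 = 1 := by
  rw [prim_emb]
  calc _ = ∫ _ in (0 : ℝ)..(1 : unitInterval), (1 : ℝ) := rfl
    _ = 1 := by simp

theorem abs_prim_apply_le (w : L2) (x : unitInterval) : |prim w x| ≤ ‖w‖ := abs_primitiveAt_le x w

theorem norm_one_le : ‖(1 : C(unitInterval, ℝ))‖ ≤ 1 :=
  (ContinuousMap.norm_le _ zero_le_one).2 fun x => by simp

theorem norm_smul_one_add_prim_le (c : ℝ) (w : L2) :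
    ‖c • (1 : C(unitInterval, ℝ)) + prim w‖ ≤ |c| + ‖w‖ := by
  refine (norm_add_le _ _).trans (add_le_add ?_ (norm_prim_le w))
  rw [norm_smul, Real.norm_eq_abs]
  exact mul_le_of_le_one_right (abs_nonneg c) norm_one_le

/-- The energy seminorm and the mean of `u` together control the norm of the state space: the
energy seminorm vanishes exactly on the constant displacements. -/
theorem norm_le_meanU_add_energySeminorm (hc₁ : 0 < c₁) (hc₂ : 0 < c₂) (X : State) :
    ‖X‖ ≤ (2 / c₁ + 1 / c₂ + 1) * (|meanU X| + energySeminorm c₁ c₂ X) := by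
  have he := energySeminorm_nonneg (c₁ := c₁) (c₂ := c₂) X
  set e := energySeminorm c₁ c₂ X
  have h1 := norm_uD_le_energySeminorm (c₂ := c₂) hc₁ X
  have h2 := norm_vD_le_energySeminorm (c₁ := c₁) hc₂ X
  have h3 := norm_utL_le_energySeminorm (c₁ := c₁) (c₂ := c₂) X
  have h4 := norm_vtL_le_energySeminorm (c₁ := c₁) (c₂ := c₂) X
  have h5 : |uC X 0| ≤ |meanU X| + ‖uD X‖ := by
    have e1 : meanU X = uC X 0 + prim (emb (prim (uD X))) 1 := by
      rw [meanU_apply]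
      conv_lhs => rw [uC_eq X]
      simp [prim_emb_one]
    have e2 : |prim (emb (prim (uD X))) 1| ≤ ‖uD X‖ :=
      (abs_prim_apply_le _ _).trans ((norm_emb_le _).trans (norm_prim_le _))
    rw [e1, abs_le] at *
    have h6 := neg_abs_le (uC X 0 + prim (emb (prim (uD X))) 1)
    have h7 := le_abs_self (uC X 0 + prim (emb (prim (uD X))) 1)
    constructor <;> linarith [e2.1, e2.2]
  have h6 : ‖uC X‖ ≤ |meanU X| + 2 * ‖uD X‖ := by
    have := norm_smul_one_add_prim_le (uC X 0) (uD X)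
    rw [← uC_eq X] at this
    linarith
  have h7 : ‖vC X‖ ≤ ‖uC X‖ + ‖vD X‖ := by
    have := norm_smul_one_add_prim_le (vC X 0) (vD X)
    rw [← vC_eq X, ← uC_one] at this
    have := (uC X).norm_coe_le_norm 1
    rw [Real.norm_eq_abs] at this
    linarith
  have k1 : 0 ≤ 1 / c₁ * e := by positivity
  have k2 : 0 ≤ 1 / c₂ * e := by positivity
  have k3 : 0 ≤ 2 / c₁ * |meanU X| := by positivity
  have k4 : 0 ≤ 1 / c₂ * |meanU X| := by positivity
  have k5 : 2 / c₁ * e = 2 * (1 / c₁ * e) := by ring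
  have k6 := abs_nonneg (meanU X)
  rw [norm_state_le_iff, add_mul, add_mul, mul_add, mul_add, one_mul, k5]
  refine ⟨?_, ?_, ?_, ?_, ?_, ?_⟩ <;> linarith

end Energy

/-- `N` is a seminorm equivalent to the energy seminorm, with constants `m` and `M`, which does not
increase along the closed loop. -/
structure IsLyapunov (c₁ c₂ g h q : ℝ) (N : Seminorm ℝ State) (m M : ℝ) : Prop where
  c₁_pos : 0 < c₁
  c₂_pos : 0 < c₂
  m_pos : 0 < m
  M_pos : 0 < M
  lower : ∀ X, m * energySeminorm c₁ c₂ X ≤ N X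
  upper : ∀ X, N X ≤ M * energySeminorm c₁ c₂ X
  deriv : ∀ X Z : State, (X, Z) ∈ graph c₁ c₂ g h q →
    ∃ d : ℝ, HasDerivWithinAt (fun τ : ℝ => N (X + τ • Z)) d (Set.Ici 0) 0 ∧ d ≤ 0

namespace IsLyapunov

variable {c₁ c₂ g h q m M : ℝ} {N : Seminorm ℝ State}

/-- The resolvent estimate: `N(X + τ TX) ≥ (1 + τ r) N(X) - τ N(rX - TX)` with equality at
`τ = 0`, so the derivatives at `0` compare. -/
theorem mul_le (hN : IsLyapunov c₁ c₂ g h q N m M) {X Z : State}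
    (hXZ : (X, Z) ∈ graph c₁ c₂ g h q) {r : ℝ} (hr : 0 ≤ r) : r * N X ≤ N (r • X - Z) := by
  obtain ⟨d, hd, hd0⟩ := hN.deriv X Z hXZ
  have h1 := hd.mono Set.Ioi_subset_Ici_self
  rw [hasDerivWithinAt_iff_tendsto_slope' (Set.notMem_Ioi.2 le_rfl)] at h1
  have h2 : r * N X - N (r • X - Z) ≤ d := by
    refine ge_of_tendsto h1 ?_
    filter_upwards [self_mem_nhdsWithin] with τ hτ
    have hτ' : 0 < τ := hτ
    have e : (1 + τ * r) • X = (X + τ • Z) + τ • (r • X - Z) := by module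
    have h3 := map_add_le_add N (X + τ • Z) (τ • (r • X - Z))
    rw [← e, map_smul_eq_mul, map_smul_eq_mul, Real.norm_of_nonneg (by positivity),
      Real.norm_of_nonneg hτ'.le] at h3
    rw [slope_def_field, sub_zero, zero_smul, add_zero, le_div_iff₀ hτ']
    nlinarith
  linarith

theorem energySeminorm_eq_zero (hN : IsLyapunov c₁ c₂ g h q N m M) {X : State} (hX : N X ≤ 0) :
    energySeminorm c₁ c₂ X = 0 := by
  have h1 := hN.lower X
  have h2 := energySeminorm_nonneg (c₁ := c₁) (c₂ := c₂) X
  have := hN.m_pos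
  nlinarith

theorem components_eq_zero (hN : IsLyapunov c₁ c₂ g h q N m M) {X : State} (hX : N X ≤ 0) :
    uD X = 0 ∧ utL X = 0 ∧ vD X = 0 ∧ vtL X = 0 := by
  have he := hN.energySeminorm_eq_zero hX
  have h1 := norm_uD_le_energySeminorm (c₂ := c₂) hN.c₁_pos X
  have h2 := norm_vD_le_energySeminorm (c₁ := c₁) hN.c₂_pos X
  have h3 := norm_utL_le_energySeminorm (c₁ := c₁) (c₂ := c₂) X
  have h4 := norm_vtL_le_energySeminorm (c₁ := c₁) (c₂ := c₂) X
  rw [he] at h1 h2 h3 h4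
  rw [mul_zero] at h1 h2
  exact ⟨norm_le_zero_iff.1 h1, norm_le_zero_iff.1 h3, norm_le_zero_iff.1 h2,
    norm_le_zero_iff.1 h4⟩

/-- There is no positive eigenvalue. -/
theorem eq_zero_of_mem_graph (hN : IsLyapunov c₁ c₂ g h q N m M) {X : State} {r : ℝ} (hr : 0 < r)
    (hX : (X, r • X) ∈ graph c₁ c₂ g h q) : X = 0 := by
  have h1 := hN.mul_le hX hr.le
  rw [sub_self, map_zero] at h1
  obtain ⟨h2, h3, h4, h5⟩ := hN.components_eq_zero (by nlinarith : N X ≤ 0)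
  obtain ⟨h6, h7, -⟩ := mem_graph_iff.1 hX
  have h8 : uC X = 0 := by
    have := emb_injective (h6.symm.trans (h3.trans (map_zero emb).symm))
    rw [map_smul, smul_eq_zero] at this
    exact this.resolve_left hr.ne'
  have h9 : vC X = 0 := by
    have := emb_injective (h7.symm.trans (h5.trans (map_zero emb).symm))
    rw [map_smul, smul_eq_zero] at this
    exact this.resolve_left hr.ne'
  exact ext_components (by simpa using h8) (by simpa using h2) (by simpa using h3)
    (by simpa using h9) (by simpa using h4) (by simpa using h5)

/-- The norm `N(X) + m |∫₀¹ u|` of the state space, for which the closed loop is dissipative up to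
the growth rate `1`. -/
def growthNorm (N : Seminorm ℝ State) (m : ℝ) : Seminorm ℝ State :=
  N + (normSeminorm ℝ ℝ).comp (m • (meanU : State →ₗ[ℝ] ℝ))

theorem growthNorm_apply (hN : IsLyapunov c₁ c₂ g h q N m M) (X : State) :
    growthNorm N m X = N X + m * |meanU X| := by
  change N X + ‖m * meanU X‖ = _
  rw [norm_mul, Real.norm_of_nonneg hN.m_pos.le, Real.norm_eq_abs]

theorem isGenerator (hN : IsLyapunov c₁ c₂ g h q N m M)
    (hdense : Dense {X : State | ∃ Z, (X, Z) ∈ graph c₁ c₂ g h q})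
    (hrange : ∀ r : ℝ, 0 < r → ∀ F : State, ∃ X, (X, r • (X - F)) ∈ graph c₁ c₂ g h q) :
    IsGenerator (E := State) (graph c₁ c₂ g h q) (growthNorm N m) where
  closed := isClosed_graph c₁ c₂ g h q
  dense := hdense
  norm_le := by
    have hm := hN.m_pos
    have := hN.c₁_pos
    have := hN.c₂_pos
    refine ⟨(2 / c₁ + 1 / c₂ + 1) * (1 / m), fun X => ?_⟩
    refine (norm_le_meanU_add_energySeminorm hN.c₁_pos hN.c₂_pos X).trans ?_
    rw [mul_assoc, hN.growthNorm_apply, one_div_mul_eq_div]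
    gcongr
    rw [le_div_iff₀ hm]
    linarith [hN.lower X]
  le_norm := by
    have hm := hN.m_pos
    have hM := hN.M_pos
    refine ⟨M * Real.sqrt (c₁ ^ 2 + 1 + c₂ ^ 2 + 1) + m, fun X => ?_⟩
    have h1 : |meanU X| ≤ ‖X‖ := (abs_prim_apply_le _ _).trans
      ((norm_emb_le _).trans (norm_state_le_iff.1 (le_refl ‖X‖)).1)
    rw [hN.growthNorm_apply, add_mul, mul_assoc]
    exact add_le_add ((hN.upper X).trans (by gcongr; exact energySeminorm_le_norm X)) (by gcongr)
  range n F := hrange _ (by positivity) F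
  bound n X F hXF := by
    have hm := hN.m_pos
    have hn : (0 : ℝ) < (n : ℝ) + 1 := by positivity
    have h1 := hN.mul_le hXF hn.le
    have e1 : ((n : ℝ) + 1) • X - ((n : ℝ) + 1) • (X - F) = ((n : ℝ) + 1) • F := by module
    rw [e1, map_smul_eq_mul, Real.norm_of_nonneg hn.le] at h1
    have h2 : N X ≤ N F := le_of_mul_le_mul_left h1 hn
    -- the mean of `TX` is the integral of `u_t`, which the energy controls
    have h3 : |((n : ℝ) + 1) * (meanU X - meanU F)| ≤ energySeminorm c₁ c₂ X := by
      have : ((n : ℝ) + 1) * (meanU X - meanU F) = prim (utL X) 1 := by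
        rw [(mem_graph_iff.1 hXF).1, ← meanU_apply, map_smul, map_sub, smul_eq_mul]
      rw [this]
      exact (abs_prim_apply_le _ _).trans (norm_utL_le_energySeminorm X)
    rw [abs_mul, abs_of_pos hn] at h3
    have h4 : m * |meanU X - meanU F| ≤ 1 / ((n : ℝ) + 1) * N F := by
      rw [one_div_mul_eq_div, le_div_iff₀ hn]
      calc _ = m * (((n : ℝ) + 1) * |meanU X - meanU F|) := by ring
        _ ≤ m * energySeminorm c₁ c₂ X := by gcongr
        _ ≤ N F := (hN.lower X).trans h2
    have h5 : |meanU X| ≤ |meanU F| + |meanU X - meanU F| := by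
      have := abs_add_le (meanU F) (meanU X - meanU F)
      rwa [add_sub_cancel] at this
    have h6 : 0 ≤ 1 / ((n : ℝ) + 1) * (m * |meanU F|) := by positivity
    rw [hN.growthNorm_apply, hN.growthNorm_apply, add_mul, one_mul, mul_add (1 / ((n : ℝ) + 1))]
    nlinarith

end IsLyapunov

/-! ### Solvability of the resolvent equation -/

section Resolvent

/-- The scalar equation `z' = κ z + φ` with `φ ∈ L²`: the difference of `z` and the primitive of
`φ` solves an equation with continuous data, for which variation of constants is classical. -/
theorem exists_eq_smul_one_add_prim (κ z₀ : ℝ) (φ : L2) :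
    ∃ z : C(unitInterval, ℝ), z = z₀ • 1 + prim (κ • emb z + φ) := by
  set Φ : ℝ → ℝ := Set.IccExtend zero_le_one (prim φ) with hΦ
  have hΦc : Continuous Φ := continuous_iccExtend _
  set w : ℝ → ℝ := fun x =>
    Real.exp (κ * x) * (z₀ + κ * ∫ y in (0 : ℝ)..x, Real.exp (-(κ * y)) * Φ y) with hw
  have hint : Continuous fun y => Real.exp (-(κ * y)) * Φ y := by fun_prop
  have hd : ∀ x, HasDerivAt w (κ * (w x + Φ x)) x := fun x => by
    have h1 : HasDerivAt (fun x => Real.exp (κ * x)) (Real.exp (κ * x) * κ) x := by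
      simpa using ((hasDerivAt_id x).const_mul κ).exp
    have h2 := h1.mul (((hint.integral_hasStrictDerivAt 0 x).hasDerivAt.const_mul κ).const_add z₀)
    convert! h2 using 1
    have h3 : Real.exp (κ * x) * Real.exp (-(κ * x)) = 1 := by
      rw [← Real.exp_add, add_neg_cancel, Real.exp_zero]
    simp only [hw]
    linear_combination (-κ * Φ x) * h3
  have hwc : Continuous w := continuous_iff_continuousAt.2 fun x => (hd x).continuousAt
  refine ⟨⟨fun x => w x + Φ x, by fun_prop⟩, ?_⟩
  ext x
  have hΦx : Φ x = prim φ x := Set.IccExtend_val _ _ _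
  have h1 : prim (emb ⟨fun x : unitInterval => w x + Φ x, by fun_prop⟩) x
      = ∫ y in (0 : ℝ)..x, (w y + Φ y) := by
    rw [prim_emb]
    refine intervalIntegral.integral_congr fun y hy => ?_
    rw [Set.uIcc_of_le x.2.1] at hy
    have hy' : y ∈ Set.Icc (0 : ℝ) 1 := ⟨hy.1, hy.2.trans x.2.2⟩
    exact Set.IccExtend_of_mem _ _ hy'
  have h2 : κ * ∫ y in (0 : ℝ)..x, (w y + Φ y) = w x - w 0 := by
    rw [← intervalIntegral.integral_const_mul]
    exact intervalIntegral.integral_eq_sub_of_hasDerivAt (fun y _ => hd y)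
      (by apply Continuous.intervalIntegrable; fun_prop)
  have h3 : w 0 = z₀ := by simp [hw]
  have h4 : (z₀ • (1 : C(unitInterval, ℝ)) + prim (κ • emb ⟨fun x : unitInterval => w x + Φ x,
      by fun_prop⟩ + φ)) x = z₀ + (κ * prim (emb ⟨fun x : unitInterval => w x + Φ x,
      by fun_prop⟩) x + prim φ x) := by simp
  rw [h4, h1, h2, h3, ← hΦx]
  change w x + Φ x = _
  ring

/-- The initial value problem `a' = b`, `b' = κ² a - φ`, which decouples in the unknowns
`b ± κ a`. -/
theorem exists_solution_system {κ : ℝ} (hκ : 0 < κ) (φ : L2) (a₀ b₀ : ℝ) :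
    ∃ a b : C(unitInterval, ℝ), a = a₀ • 1 + prim (emb b) ∧
      b = b₀ • 1 + prim (κ ^ 2 • emb a - φ) := by
  obtain ⟨A, hA⟩ := exists_eq_smul_one_add_prim κ (b₀ + κ * a₀) (-φ)
  obtain ⟨B, hB⟩ := exists_eq_smul_one_add_prim (-κ) (b₀ - κ * a₀) (-φ)
  refine ⟨(2 * κ)⁻¹ • (A - B), (2 : ℝ)⁻¹ • (A + B), ?_, ?_⟩
  · conv_lhs => rw [hA, hB]
    simp only [map_add, map_smul, map_neg]
    match_scalars <;> field_simp <;> ring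
  · conv_lhs => rw [hA, hB]
    simp only [map_add, map_smul, map_sub, map_neg]
    match_scalars <;> field_simp <;> ring

variable {c₁ c₂ g h q : ℝ}

/-- Shooting from the end of the string: for a prescribed value `u(0)` the resolvent equation has a
solution that satisfies every condition but the one at the end of the controller. -/
theorem exists_shooting (hc₁ : 0 < c₁) (hc₂ : 0 < c₂) {r : ℝ} (hr : 0 < r) (F : State) (α : ℝ) :
    ∃ (X : State) (ρ : ℝ), uC X 0 = α ∧
      graphMap c₁ c₂ g h q (X, r • (X - F)) = (0, 0, 0, 0, ρ) := by
  obtain ⟨a, b, ha, hb⟩ := exists_solution_system (div_pos hr hc₁)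
    ((c₁ ^ 2)⁻¹ • r • (r • emb (uC F) + utL F)) α (g * (r * (α - uC F 0)))
  obtain ⟨a', b', ha', hb'⟩ := exists_solution_system (div_pos hr hc₂)
    ((c₂ ^ 2)⁻¹ • r • (r • emb (vC F) + vtL F)) (a 1) (b 1)
  have ha0 : a 0 = α := by rw [ha]; simp
  have ha0' : a' 0 = a 1 := by rw [ha']; simp
  set X : State := ofComponents a (emb b) (r • (emb a - emb (uC F))) a' (emb b')
    (r • (emb a' - emb (vC F))) (by rw [ha0]; exact ha) (by rw [ha0']; exact ha') ha0'.symm with hX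
  have e1 : uC X = a := rfl
  have e2 : uD X = emb b := rfl
  have e3 : utL X = r • (emb a - emb (uC F)) := rfl
  have e4 : vC X = a' := rfl
  have e5 : vD X = emb b' := rfl
  have e6 : vtL X = r • (emb a' - emb (vC F)) := rfl
  have eu : uxL c₁ g (r • (X - F)) = b := by
    rw [uxL_apply]
    conv_rhs => rw [hb]
    simp only [map_smul, map_sub, map_add, e1, e3, ContinuousMap.smul_apply,
      ContinuousMap.sub_apply, smul_eq_mul, ha0]
    match_scalars <;> field_simp
  have ev : vxL c₁ c₂ g (r • (X - F)) = b' := by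
    rw [vxL_apply, eu]
    conv_rhs => rw [hb']
    simp only [map_smul, map_sub, map_add, e6]
    match_scalars <;> field_simp
  refine ⟨X, (graphMap c₁ c₂ g h q (X, r • (X - F))).2.2.2.2, by rw [e1, ha0], ?_⟩
  have f1 : utL X - emb (uC (r • (X - F))) = 0 := by
    rw [e3, map_smul, map_smul, map_sub, map_sub, e1, sub_self]
  have f2 : vtL X - emb (vC (r • (X - F))) = 0 := by
    rw [e6, map_smul, map_smul, map_sub, map_sub, e4, sub_self]
  have f3 : uD X - emb (uxL c₁ g (r • (X - F))) = 0 := by rw [eu, e2, sub_self]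
  have f4 : vD X - emb (vxL c₁ c₂ g (r • (X - F))) = 0 := by rw [ev, e5, sub_self]
  exact Prod.ext f1 (Prod.ext f2 (Prod.ext f3 (Prod.ext f4 rfl)))

/-- The resolvent equation is solvable: the defect at the end of the controller is affine in the
shooting parameter, and not constant, since there is no positive eigenvalue. -/
theorem IsLyapunov.exists_mem_graph {N : Seminorm ℝ State} {m M : ℝ}
    (hN : IsLyapunov c₁ c₂ g h q N m M) {r : ℝ} (hr : 0 < r) (F : State) :
    ∃ X, (X, r • (X - F)) ∈ graph c₁ c₂ g h q := by
  obtain ⟨Y, σ, -, hY⟩ := exists_shooting (g := g) (h := h) (q := q) hN.c₁_pos hN.c₂_pos hr F 0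
  obtain ⟨W, ρ, hW1, hW⟩ := exists_shooting (g := g) (h := h) (q := q) hN.c₁_pos hN.c₂_pos hr 0 1
  have hρ : ρ ≠ 0 := by
    rintro rfl
    rw [sub_zero] at hW
    have hmem : (W, r • W) ∈ graph c₁ c₂ g h q := hW
    rw [hN.eq_zero_of_mem_graph hr hmem] at hW1
    simp at hW1
  refine ⟨Y - (σ / ρ) • W, ?_⟩
  have e : (Y - (σ / ρ) • W, r • (Y - (σ / ρ) • W - F))
      = (Y, r • (Y - F)) - (σ / ρ) • (W, r • (W - 0)) := by
    rw [Prod.smul_mk, Prod.mk_sub_mk]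
    congr 1
    module
  change graphMap c₁ c₂ g h q _ = 0
  rw [e, map_sub, map_smul, hY, hW]
  simp [hρ]

end Resolvent

/-! ### Density of the domain -/

section Density

/-- The functions of `H¹` vanishing at both ends, as a subspace of `L²`. -/
def h10 : Submodule ℝ L2 :=
  ((ContinuousMap.evalCLM ℝ (1 : unitInterval)).comp prim).ker.map (emb.comp prim).toLinearMap

theorem mem_h10_iff {s : L2} : s ∈ h10 ↔ ∃ w : L2, prim w 1 = 0 ∧ emb (prim w) = s := by
  simp [h10, Submodule.mem_map]

/-- A `C¹` function supported in the open interval restricts to an element of `h10`. -/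
theorem emb_mem_h10 {f : ℝ → ℝ} (hf : ContDiff ℝ 1 f) (hsupp : tsupport f ⊆ Set.Ioo 0 1) :
    emb ⟨fun x : unitInterval => f x, by have := hf.continuous; fun_prop⟩ ∈ h10 := by
  have hf0 : f 0 = 0 := image_eq_zero_of_notMem_tsupport fun h => lt_irrefl _ (hsupp h).1
  have hf1 : f 1 = 0 := image_eq_zero_of_notMem_tsupport fun h => lt_irrefl _ (hsupp h).2
  have hc : Continuous (deriv f) := hf.continuous_deriv (by simp)
  have e : prim (emb ⟨fun x : unitInterval => deriv f x, by fun_prop⟩)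
      = ⟨fun x : unitInterval => f x, by have := hf.continuous; fun_prop⟩ := by
    ext x
    rw [prim_emb]
    have h1 : ∫ y in (0 : ℝ)..x, deriv f y = f x - f 0 :=
      intervalIntegral.integral_deriv_eq_sub (fun y _ => hf.differentiable (by simp) y)
        (hc.intervalIntegrable _ _)
    rw [hf0, sub_zero] at h1
    refine Eq.trans ?_ h1
    refine intervalIntegral.integral_congr fun y hy => ?_
    rw [Set.uIcc_of_le x.2.1] at hy
    have hy' : y ∈ Set.Icc (0 : ℝ) 1 := ⟨hy.1, hy.2.trans x.2.2⟩
    exact Set.IccExtend_of_mem _ _ hy'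
  refine mem_h10_iff.2 ⟨_, ?_, congrArg emb e⟩
  rw [e]
  exact hf1

theorem dense_h10 : Dense (h10 : Set L2) := by
  rw [Submodule.dense_iff_topologicalClosure_eq_top, Submodule.topologicalClosure_eq_top_iff,
    Submodule.eq_bot_iff]
  intro f hf
  have hint : Integrable (fun y => f y) (volume.restrict (Set.Icc (0 : ℝ) 1)) :=
    (Lp.memLp f).integrable (by norm_num)
  have h1 := isOpen_Ioo.ae_eq_zero_of_integral_contDiff_smul_eq_zero
    (U := Set.Ioo (0 : ℝ) 1) (f := fun y => f y) (μ := volume.restrict (Set.Icc (0 : ℝ) 1))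
    (hint.locallyIntegrable.locallyIntegrableOn _) fun φ hφ _ hsupp => by
      have h2 := (Submodule.mem_orthogonal _ _).1 hf _ (emb_mem_h10 (hφ.of_le (by simp)) hsupp)
      rw [L2.inner_def] at h2
      refine Eq.trans ?_ h2
      refine integral_congr_ae ?_
      filter_upwards [coeFn_emb ⟨fun x : unitInterval => φ x, by
        have := hφ.continuous; fun_prop⟩, ae_restrict_mem measurableSet_Icc] with x hx hx'
      rw [hx, Set.IccExtend_of_mem _ _ hx']
      simp [mul_comm]
  rw [Lp.eq_zero_iff_ae_eq_zero]
  have h3 : ∀ᵐ x ∂(volume.restrict (Set.Icc (0 : ℝ) 1)), x ∈ Set.Ioo (0 : ℝ) 1 := by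
    rw [← restrict_Ioo_eq_restrict_Icc]
    exact ae_restrict_mem measurableSet_Ioo
  filter_upwards [h1, h3] with x hx hx'
  exact hx hx'

/-- The state with given `u_x`, `u_t`, `v_x`, `v_t`, and with `v(1) = 0`. -/
def ofDerivs : (L2 × L2 × L2 × L2) →L[ℝ] State :=
  let one : ℝ →L[ℝ] C(unitInterval, ℝ) := .toSpanSingleton ℝ 1
  let centered : L2 →L[ℝ] C(unitInterval, ℝ) :=
    prim - one.comp ((ContinuousMap.evalCLM ℝ (1 : unitInterval)).comp prim)
  let p₁ : (L2 × L2 × L2 × L2) →L[ℝ] L2 := .fst ℝ _ _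
  let p₂ : (L2 × L2 × L2 × L2) →L[ℝ] L2 := (ContinuousLinearMap.fst ℝ _ _).comp (.snd ℝ _ _)
  let p₃ : (L2 × L2 × L2 × L2) →L[ℝ] L2 :=
    (ContinuousLinearMap.fst ℝ _ _).comp ((ContinuousLinearMap.snd ℝ _ _).comp (.snd ℝ _ _))
  let p₄ : (L2 × L2 × L2 × L2) →L[ℝ] L2 :=
    (ContinuousLinearMap.snd ℝ _ _).comp ((ContinuousLinearMap.snd ℝ _ _).comp (.snd ℝ _ _))
  ContinuousLinearMap.codRestrict
    (((centered.comp p₁ + one.comp ((ContinuousMap.evalCLM ℝ (0 : unitInterval)).comp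
      (centered.comp p₃))).prod p₁).prod (p₂.prod (((centered.comp p₃).prod p₃).prod p₄)))
    stateSubmodule fun w => by
      refine ⟨(mem_h1Submodule_iff _ _).2 ?_, (mem_h1Submodule_iff _ _).2 ?_, ?_⟩
      · ext x
        simp [one, centered, p₁, p₃]
        ring
      · ext x
        simp [one, centered, p₃]
        ring
      · simp [one, centered, p₁, p₃]

theorem vC_ofDerivs (w₁ w₂ w₃ w₄ : L2) :
    vC (ofDerivs (w₁, w₂, w₃, w₄)) = prim w₃ - prim w₃ 1 • 1 := rfl

theorem uC_ofDerivs (w₁ w₂ w₃ w₄ : L2) :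
    uC (ofDerivs (w₁, w₂, w₃, w₄))
      = prim w₁ - prim w₁ 1 • 1 + (prim w₃ - prim w₃ 1 • 1) 0 • 1 := rfl

theorem uD_ofDerivs (w : L2 × L2 × L2 × L2) : uD (ofDerivs w) = w.1 := rfl

theorem utL_ofDerivs (w : L2 × L2 × L2 × L2) : utL (ofDerivs w) = w.2.1 := rfl

theorem vD_ofDerivs (w : L2 × L2 × L2 × L2) : vD (ofDerivs w) = w.2.2.1 := rfl

theorem vtL_ofDerivs (w : L2 × L2 × L2 × L2) : vtL (ofDerivs w) = w.2.2.2 := rfl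

/-- The state `u = v = 1` at rest. -/
def oneState : State :=
  ofComponents 1 0 0 1 0 0 (by ext; simp) (by ext; simp) (by simp)

theorem eq_smul_oneState_add (X : State) :
    X = vC X 1 • oneState + ofDerivs (uD X, utL X, vD X, vtL X) := by
  have h1 : uC oneState = 1 := rfl
  have h2 : vC oneState = 1 := rfl
  have h3 : uD oneState = 0 := rfl
  have h4 : vD oneState = 0 := rfl
  have h5 : utL oneState = 0 := rfl
  have h6 : vtL oneState = 0 := rfl
  have e1 : vC X 1 = vC X 0 + prim (vD X) 1 := by
    conv_lhs => rw [vC_eq X]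
    simp
  have e2 : vC X 0 = uC X 0 + prim (uD X) 1 := by
    rw [← uC_one]
    conv_lhs => rw [uC_eq X]
    simp
  refine ext_components ?_ ?_ ?_ ?_ ?_ ?_
  · rw [map_add, map_smul, h1, uC_ofDerivs]
    conv_lhs => rw [uC_eq X]
    ext x
    simp
    linarith
  · rw [map_add, map_smul, h3, uD_ofDerivs, smul_zero, zero_add]
  · rw [map_add, map_smul, h5, utL_ofDerivs, smul_zero, zero_add]
  · rw [map_add, map_smul, h2, vC_ofDerivs]
    conv_lhs => rw [vC_eq X]
    ext x
    simp
    linarith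
  · rw [map_add, map_smul, h4, vD_ofDerivs, smul_zero, zero_add]
  · rw [map_add, map_smul, h6, vtL_ofDerivs, smul_zero, zero_add]

variable {c₁ c₂ g h q : ℝ}

variable (c₁ c₂ g h q) in
/-- The domain of the closed-loop operator. -/
def domain : Submodule ℝ State := (graph c₁ c₂ g h q).map (LinearMap.fst ℝ State State)

theorem mem_domain_iff {X : State} :
    X ∈ domain c₁ c₂ g h q ↔ ∃ Z, (X, Z) ∈ graph c₁ c₂ g h q := by
  simp [domain]

/-- If all derivatives vanish at the ends, then so do all terms of the boundary conditions. -/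
theorem ofDerivs_mem_domain (hc₁ : 0 < c₁) (hc₂ : 0 < c₂) {s₁ s₂ s₃ s₄ : L2} (h₁ : s₁ ∈ h10)
    (h₂ : s₂ ∈ h10) (h₃ : s₃ ∈ h10) (h₄ : s₄ ∈ h10) :
    ofDerivs (s₁, s₂, s₃, s₄) ∈ domain c₁ c₂ g h q := by
  obtain ⟨w₁, hw₁, rfl⟩ := mem_h10_iff.1 h₁
  obtain ⟨w₂, hw₂, rfl⟩ := mem_h10_iff.1 h₂
  obtain ⟨w₃, hw₃, rfl⟩ := mem_h10_iff.1 h₃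
  obtain ⟨w₄, hw₄, rfl⟩ := mem_h10_iff.1 h₄
  set Z : State := ofComponents (prim w₂) w₂ (c₁ ^ 2 • w₁) (prim w₄) w₄ (c₂ ^ 2 • w₃)
    (by simp) (by simp) (by rw [hw₂, prim_zero_right]) with hZ
  have e1 : uC Z = prim w₂ := rfl
  have e2 : vC Z = prim w₄ := rfl
  have e3 : utL Z = c₁ ^ 2 • w₁ := rfl
  have e4 : vtL Z = c₂ ^ 2 • w₃ := rfl
  have eu : uxL c₁ g Z = prim w₁ := by
    rw [uxL_apply, e1, e3, prim_zero_right, mul_zero, zero_smul, zero_add, map_smul, smul_smul,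
      inv_mul_cancel₀ (by positivity), one_smul]
  have ev : vxL c₁ c₂ g Z = prim w₃ := by
    rw [vxL_apply, eu, e4, hw₁, zero_smul, zero_add, map_smul, smul_smul,
      inv_mul_cancel₀ (by positivity), one_smul]
  refine mem_domain_iff.2 ⟨Z, mem_graph_iff.2 ⟨?_, ?_, ?_, ?_, ?_⟩⟩
  · rw [utL_ofDerivs, e1]
  · rw [vtL_ofDerivs, e2]
  · rw [uD_ofDerivs, eu]
  · rw [vD_ofDerivs, ev]
  · rw [ev, e2, hw₃, hw₄, vC_ofDerivs]
    simp

theorem ofDerivs_mem_closure_domain (hc₁ : 0 < c₁) (hc₂ : 0 < c₂) (w : L2 × L2 × L2 × L2) :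
    ofDerivs w ∈ (domain c₁ c₂ g h q).topologicalClosure :=
  map_mem_closure ofDerivs.continuous
    ((dense_h10.prod (dense_h10.prod (dense_h10.prod dense_h10))) w)
    fun _ hs => ofDerivs_mem_domain hc₁ hc₂ hs.1 hs.2.1 hs.2.2.1 hs.2.2.2

/-- The displacement `v` with `v(1) = 1` and `v_x = -q x` satisfies the condition at the end of the
controller with zero velocities. -/
theorem oneState_add_mem_domain (hc₂ : 0 < c₂) :
    oneState + ofDerivs (0, 0, -q • emb (prim (emb 1)), 0) ∈ domain c₁ c₂ g h q := by
  set Z : State := ofComponents 0 0 0 0 0 (c₂ ^ 2 • -q • emb 1) (by simp) (by simp) rfl with hZ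
  have e1 : uC Z = 0 := rfl
  have e2 : vC Z = 0 := rfl
  have e3 : utL Z = 0 := rfl
  have e4 : vtL Z = c₂ ^ 2 • -q • emb 1 := rfl
  have h2 : vC oneState = 1 := rfl
  have h3 : uD oneState = 0 := rfl
  have h4 : vD oneState = 0 := rfl
  have h5 : utL oneState = 0 := rfl
  have h6 : vtL oneState = 0 := rfl
  have eu : uxL c₁ g Z = 0 := by
    rw [uxL_apply, e1, e3]
    simp
  have ev : vxL c₁ c₂ g Z = -q • prim (emb 1) := by
    rw [vxL_apply, eu, e4, map_smul, map_smul, smul_smul, inv_mul_cancel₀ (by positivity),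
      one_smul]
    simp
  refine mem_domain_iff.2 ⟨Z, mem_graph_iff.2 ⟨?_, ?_, ?_, ?_, ?_⟩⟩
  · rw [map_add, h5, utL_ofDerivs, e1, map_zero, zero_add]
  · rw [map_add, h6, vtL_ofDerivs, e2, map_zero, zero_add]
  · rw [map_add, h3, uD_ofDerivs, eu, map_zero, zero_add]
  · rw [map_add, h4, vD_ofDerivs, ev, zero_add, map_smul]
  · rw [ev, e2, map_add, h2, vC_ofDerivs]
    simp [prim_emb_one]

theorem dense_domain (hc₁ : 0 < c₁) (hc₂ : 0 < c₂) :
    Dense {X : State | ∃ Z, (X, Z) ∈ graph c₁ c₂ g h q} := by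
  have e : {X : State | ∃ Z, (X, Z) ∈ graph c₁ c₂ g h q} = (domain c₁ c₂ g h q : Set State) :=
    Set.ext fun X => mem_domain_iff.symm
  have h1 : oneState ∈ (domain c₁ c₂ g h q).topologicalClosure := by
    have h2 := Submodule.sub_mem _
      ((domain c₁ c₂ g h q).le_topologicalClosure (oneState_add_mem_domain hc₂))
      (ofDerivs_mem_closure_domain hc₁ hc₂ (0, 0, -q • emb (prim (emb 1)), 0))
    rwa [add_sub_cancel_right] at h2
  rw [e]
  intro X
  rw [eq_smul_oneState_add X]
  exact Submodule.add_mem _ (Submodule.smul_mem _ _ h1) (ofDerivs_mem_closure_domain hc₁ hc₂ _)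

end Density

/-! ### Integrals of curves on `[0, ∞)` -/

section Primitive

variable {E : Type*} [NormedAddCommGroup E] {W : ℝ → E}

theorem intervalIntegrable_of_continuousOn_Ici (hW : ContinuousOn W (Set.Ici 0)) {t : ℝ}
    (ht : 0 ≤ t) : IntervalIntegrable W volume 0 t :=
  (hW.mono (by rw [Set.uIcc_of_le ht]; exact Set.Icc_subset_Ici_self)).intervalIntegrable

variable [NormedSpace ℝ E]

theorem continuousOn_integral_Icc (hW : ContinuousOn W (Set.Ici 0)) {t : ℝ} (ht : 0 ≤ t) :
    ContinuousOn (fun t => ∫ r in (0 : ℝ)..t, W r) (Set.Icc 0 t) := by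
  have := intervalIntegral.continuousOn_primitive_interval'
    (intervalIntegrable_of_continuousOn_Ici hW ht) Set.left_mem_uIcc
  rwa [Set.uIcc_of_le ht] at this

theorem integral_sub_of_continuousOn_Ici {W' : ℝ → E} (hW : ContinuousOn W (Set.Ici 0))
    (hW' : ContinuousOn W' (Set.Ici 0)) {t : ℝ} (ht : 0 ≤ t) :
    ∫ s in (0 : ℝ)..t, (W s - W' s) = (∫ s in (0 : ℝ)..t, W s) - ∫ s in (0 : ℝ)..t, W' s :=
  intervalIntegral.integral_sub (intervalIntegrable_of_continuousOn_Ici hW ht)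
    (intervalIntegrable_of_continuousOn_Ici hW' ht)

theorem continuous_of_le_norm {p : Seminorm ℝ E} {K : ℝ} (hK : 0 ≤ K)
    (h : ∀ x, p x ≤ K * ‖x‖) : Continuous p := by
  lift K to NNReal using hK
  exact Seminorm.continuous_of_le (q := K • normSeminorm ℝ E)
    (continuous_const.mul continuous_norm) h

/-- A seminorm along a curve and along its tangent has the same right derivative. -/
theorem hasDerivWithinAt_seminorm_comp {p : Seminorm ℝ E} {K : ℝ} (hK : ∀ x, p x ≤ K * ‖x‖)
    {V : ℝ → E} {w : E} {t d : ℝ} (hV : HasDerivWithinAt V w (Set.Ici t) t)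
    (hd : HasDerivWithinAt (fun τ : ℝ => p (V t + τ • w)) d (Set.Ici 0) 0) :
    HasDerivWithinAt (fun s => p (V s)) d (Set.Ici t) t := by
  have e : HasDerivWithinAt (fun s : ℝ => p (V t + (s - t) • w)) d (Set.Ici t) t := by
    have h1 : HasDerivWithinAt (fun s : ℝ => s - t) 1 (Set.Ici t) t :=
      ((hasDerivAt_id t).sub_const t).hasDerivWithinAt
    have h2 := HasDerivWithinAt.comp (h₂ := fun τ : ℝ => p (V t + τ • w)) (h := fun s => s - t)
      t (s' := Set.Ici 0) (by rwa [sub_self]) h1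
      fun s hs => show (0 : ℝ) ≤ s - t from sub_nonneg.2 hs
    simpa [Function.comp_def] using! h2
  -- the seminorms along the curve and along its tangent differ by a term `o(s - t)`
  rw [hasDerivWithinAt_iff_isLittleO] at e hV ⊢
  have h4 : (fun s => p (V s) - p (V t + (s - t) • w)) =o[𝓝[Set.Ici t] t] fun s => s - t := by
    refine Asymptotics.IsBigO.trans_isLittleO ?_ hV
    refine Asymptotics.IsBigO.of_bound K (Eventually.of_forall fun s => ?_)
    rw [Real.norm_eq_abs, sub_sub]
    exact (abs_sub_map_le_sub p _ _).trans (hK _)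
  refine (h4.add e).congr_left fun s => ?_
  simp only [sub_self, zero_smul, add_zero]
  ring

variable [CompleteSpace E]

theorem hasDerivWithinAt_integral_Ici (hW : ContinuousOn W (Set.Ici 0)) {t : ℝ} (ht : 0 ≤ t) :
    HasDerivWithinAt (fun t => ∫ r in (0 : ℝ)..t, W r) (W t) (Set.Ici t) t := by
  have hsub : Set.Ioi t ⊆ Set.Ici (0 : ℝ) := fun r hr => ht.trans (le_of_lt hr)
  exact intervalIntegral.integral_hasDerivWithinAt_right
    (intervalIntegrable_of_continuousOn_Ici hW ht)
    ⟨Set.Ioi t, self_mem_nhdsWithin, (hW.mono hsub).aestronglyMeasurable measurableSet_Ioi⟩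
    ((hW t ht).mono hsub)

/-- A linear map that vanishes on all integrals of `W` vanishes on their derivatives. -/
theorem map_eq_zero_of_map_integral_eq_zero {F : Type*} [NormedAddCommGroup F] [NormedSpace ℝ F]
    (hW : ContinuousOn W (Set.Ici 0)) (L : E →L[ℝ] F)
    (hL : ∀ s, 0 ≤ s → L (∫ r in (0 : ℝ)..s, W r) = 0) {t : ℝ} (ht : 0 ≤ t) : L (W t) = 0 := by
  have h1 : HasDerivWithinAt (fun s => L (∫ r in (0 : ℝ)..s, W r)) (L (W t)) (Set.Ici t) t :=
    L.hasFDerivAt.comp_hasDerivWithinAt t (hasDerivWithinAt_integral_Ici hW ht)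
  have h2 : HasDerivWithinAt (fun s => L (∫ r in (0 : ℝ)..s, W r)) 0 (Set.Ici t) t :=
    (hasDerivWithinAt_const t _ (0 : F)).congr (fun s hs => hL s (ht.trans hs)) (hL t ht)
  exact (uniqueDiffWithinAt_Ici t).eq_deriv _ h1 h2

end Primitive

/-! ### Uniqueness -/

section Uniqueness

variable {c₁ c₂ g h q m M : ℝ} {N : Seminorm ℝ State}

/-- A trajectory `V' = TV` starting at zero stays in the kernel of the Lyapunov seminorm, whose
right derivative along the trajectory is not positive. -/
theorem IsLyapunov.seminorm_le_zero (hN : IsLyapunov c₁ c₂ g h q N m M) {V W : ℝ → State} {τ : ℝ}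
    (hV : ContinuousOn V (Set.Icc 0 τ)) (hV0 : V 0 = 0)
    (hd : ∀ t ∈ Set.Ico 0 τ, HasDerivWithinAt V (W t) (Set.Ici t) t)
    (hmem : ∀ t ∈ Set.Ico 0 τ, (V t, W t) ∈ graph c₁ c₂ g h q) :
    ∀ t ∈ Set.Icc 0 τ, N (V t) ≤ 0 := by
  set K : ℝ := M * Real.sqrt (c₁ ^ 2 + 1 + c₂ ^ 2 + 1)
  have hM := hN.M_pos
  have hK : ∀ X, N X ≤ K * ‖X‖ := fun X => (hN.upper X).trans <| by
    rw [mul_assoc]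
    gcongr
    exact energySeminorm_le_norm X
  have hNc : Continuous N := continuous_of_le_norm (E := State) (K := K) (by positivity) hK
  have hderiv : ∀ t ∈ Set.Ico 0 τ, ∃ d ≤ 0,
      HasDerivWithinAt (fun s => N (V s)) d (Set.Ici t) t := by
    intro t ht
    obtain ⟨d, hd1, hd0⟩ := hN.deriv _ _ (hmem t ht)
    exact ⟨d, hd0, hasDerivWithinAt_seminorm_comp (E := State) hK (hd t ht) hd1⟩
  choose! d hd0 hd' using hderiv
  intro t ht
  exact image_le_of_deriv_right_le_deriv_boundary (f := fun s => N (V s)) (B := fun _ => 0)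
    (B' := fun _ => 0) (hNc.comp_continuousOn hV) hd' (by simp [hV0]) continuousOn_const
    (fun s _ => hasDerivWithinAt_const _ _ _) hd0 ht

/-- A mild trajectory starting at zero vanishes: its integral is a displacement that is constant
in `x`, with zero velocity. -/
theorem IsLyapunov.eq_zero_of_mild (hN : IsLyapunov c₁ c₂ g h q N m M) {W : ℝ → State}
    (hW : ContinuousOn W (Set.Ici 0))
    (hmem : ∀ t, 0 ≤ t → (∫ s in (0 : ℝ)..t, W s, W t) ∈ graph c₁ c₂ g h q) {t : ℝ} (ht : 0 ≤ t) :
    W t = 0 := by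
  have hzero : ∀ s, 0 ≤ s → N (∫ r in (0 : ℝ)..s, W r) ≤ 0 := fun s hs =>
    hN.seminorm_le_zero (V := fun t => ∫ r in (0 : ℝ)..t, W r) (W := W) (τ := s)
      (continuousOn_integral_Icc hW hs) intervalIntegral.integral_same
      (fun r hr => hasDerivWithinAt_integral_Ici hW hr.1) (fun r hr => hmem r hr.1) s ⟨hs, le_rfl⟩
  obtain ⟨h1, h2, -⟩ := mem_graph_iff.1 (hmem t ht)
  obtain ⟨-, h3, -, h4⟩ := hN.components_eq_zero (hzero t ht)
  refine ext_components ?_ ?_ ?_ ?_ ?_ ?_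
  · rw [map_zero]
    exact emb_injective (h1.symm.trans (h3.trans (map_zero emb).symm))
  · rw [map_zero]
    exact map_eq_zero_of_map_integral_eq_zero hW uD
      (fun s hs => (hN.components_eq_zero (hzero s hs)).1) ht
  · rw [map_zero]
    exact map_eq_zero_of_map_integral_eq_zero hW utL
      (fun s hs => (hN.components_eq_zero (hzero s hs)).2.1) ht
  · rw [map_zero]
    exact emb_injective (h2.symm.trans (h4.trans (map_zero emb).symm))
  · rw [map_zero]
    exact map_eq_zero_of_map_integral_eq_zero hW vD
      (fun s hs => (hN.components_eq_zero (hzero s hs)).2.2.1) ht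
  · rw [map_zero]
    exact map_eq_zero_of_map_integral_eq_zero hW vtL
      (fun s hs => (hN.components_eq_zero (hzero s hs)).2.2.2) ht

end Uniqueness

end StringLoop

end

theorem mainTheorem5 (c₁ c₂ g h q : ℝ) (hc₁ : 0 < c₁) (hc₂ : 0 < c₂) (hh : 0 < h)
    (hdiss : StringLoop.IsDissipative c₁ c₂ g h q) (X₀ : StringLoop.State) :
    ∃ X : ℝ → StringLoop.State, StringLoop.IsSolution c₁ c₂ g h q X₀ X ∧
      ∀ Y : ℝ → StringLoop.State, StringLoop.IsSolution c₁ c₂ g h q X₀ Y →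
        Set.EqOn Y X (Set.Ici 0) := by
  obtain ⟨N, ⟨m, M, hm, hM, hNb⟩, hNd⟩ := hdiss
  have hN : StringLoop.IsLyapunov c₁ c₂ g h q N m M :=
    ⟨hc₁, hc₂, hm, hM, fun X => (hNb X).1, fun X => (hNb X).2,
      fun X Z hXZ => hNd X Z ((StringLoop.isOperatorValue_iff hc₁ hc₂).2 hXZ)⟩
  obtain ⟨X, hXc, hX⟩ := (hN.isGenerator (StringLoop.dense_domain hc₁ hc₂)
    fun r hr F => hN.exists_mem_graph hr F).exists_mild_solution X₀
  refine ⟨X, ⟨hXc, fun t ht => (StringLoop.isOperatorValue_iff hc₁ hc₂).2 (hX t ht)⟩, ?_⟩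
  rintro Y ⟨hYc, hY⟩ t ht
  refine sub_eq_zero.1 (hN.eq_zero_of_mild (W := fun s => Y s - X s) (hYc.sub hXc)
    (fun s hs => ?_) ht)
  have h1 := Submodule.sub_mem _ ((StringLoop.isOperatorValue_iff hc₁ hc₂).1 (hY s hs)) (hX s hs)
  have h2 : ∫ r in (0 : ℝ)..s, (Y r - X r)
      = (∫ r in (0 : ℝ)..s, Y r) - ∫ r in (0 : ℝ)..s, X r :=
    StringLoop.integral_sub_of_continuousOn_Ici hYc hXc hs
  rw [h2]
  convert! h1 using 1
  rw [Prod.mk_sub_mk, sub_sub_sub_cancel_right]
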